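/- **Setting.** Let $\mathfrak g=sl(2,\mathbb C)$ with standard basis $e,h,f$, identify $\mathfrak h^*$ with $\mathbb C$ by $\lambda\mapsto\lambda(h)$, and put $\langle\lambda,\mu\rangle=\tfrac12\lambda\mu$, $\rho=1$, $\delta(\lambda)=e^{\lambda/2}-e^{-\lambda/2}$, $(a)_n=a(a+1)\cdots(a+n-1)$. Let $M_\mu$ be the Verma module with highest weight vector $x_\mu$ of weight $\mu$, and $V_\gamma$ the irreducible module of highest weight $\gamma\in\mathbb Z_{\ge0}$. * For a finite dimensional $\mathfrak g$-module $V$, $v\in V$ of weight $\beta$ and generic $\lambda$, $\Phi_\lambda^v:M_\lambda\to M_{\lambda-\beta}\otimes V$ is the unique $\mathfrak g$-intertwining operator with $\Phi^v_\lambda(x_\lambda)\in x_{\lambda-\beta}\otimes v+\bigoplus_{\nu<\lambda-\beta}M_{\lambda-\beta}[\nu]\otimes V$. * For weight vectors $w\in W$, $v\in V$ of finite dimensional modules, $J_{WV}(\lambda)(w\otimes v)\in W\otimes V$ is the unique vector of weight $\mathrm{wt}(w)+\mathrm{wt}(v)$ with $(\Phi^w_{\lambda-\mathrm{wt}(v)}\otimes1)\Phi^v_\lambda(x_\lambda)=\Phi_\lambda^{J_{WV}(\lambda)(w\otimes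 v)}(x_\lambda)$. The universal fusion matrix $J(\lambda)$ is the generalized element of $U(\mathfrak g)\otimes U(\mathfrak g)$ acting on every $W\otimes V$ as $J_{WV}(\lambda)$, and $Q(\lambda)=(m\circ P\circ(1\otimes S^{-1}))J(\lambda)$, where $m$ is multiplication, $P$ the flip and $S$ the antipode of $U(\mathfrak g)$. $Q_V(\lambda)$ is the action of $Q(\lambda)$ on $V$; it preserves weight spaces. * For a basis $B[0]$ of $V[0]$ with dual basis $(v^*)$ of $V^*[0]$, put $\Phi_\mu^{V[0]}=\sum_{v\in B[0]}\Phi_\mu^v\otimes v^*$ and $\Psi_V(\lambda,\mu)=\mathrm{Tr}|_{M_\mu}(\Phi_\mu^{V[0]}\circ\exp_\lambda)\in V[0]\otimes V^*[0]$, where $\exp_\lambda$ acts on vectors of weight $\nu$ as $e^{\langle\lambda,\nu\rangle}$. The weighted trace function is $$F_V(\lambda,\mu)=\delta(\lambda)\,\bigl(\mathrm{id}_V\otimes Q_{V^*}^{-1}(-\mu-\rho)\bigr)\Psi_V(\lambda,-\mu-\rho).$$ **Theorem.** Let $\gamma$ be a nonnegative even integer, let $\lambda\in\mathbb C$ with $\mathrm{Re}\,\lambda>0$,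 and let $\mu\in\mathbb C$ with $\mu\notin\{-1,-2,\dots\}\cup\{1,2,\dots,\tfrac12\gamma\}$. Then the operators $\Phi_{-\mu-1}^w$ for zero weight vectors $w$, and the vectors $J_{WV}(-\mu-1)(w\otimes v)$ for zero weight vectors $w,v$, of finite dimensional modules are well defined; the operator $Q_{V_\gamma^*}(-\mu-1)$ on $V_\gamma^*[0]$ is well defined and invertible; and the series over the weights of $M_{-\mu-1}$ that defines the trace $\Psi_{V_\gamma}(\lambda,-\mu-1)$ converges. Moreover, with $v_0$ spanning $V_\gamma[0]$ and $v_0^*$ the dual vector in $V_\gamma^*[0]$, one has $F_{V_\gamma}(\lambda,\mu)=F_\gamma(\lambda,\mu)\,v_0\otimes v_0^*$ with $$F_\gamma(\lambda,\mu)=\frac{(-1)^{\gamma/2}(\mu+1)_{\gamma/2}}{(-\mu+1)_{\gamma/2}}\,e^{-\lambda\mu/2}\;{}_2F_1\!\left[{-\tfrac12\gamma,\ \tfrac12\gamma+1\atop\mu+1};(1-e^{\lambda})^{-1}\right]$$ (a terminating series), and also $$F_\gamma(\lambda,\mu)=\frac{(-1)^{\gamma/2}(\mu+1)_{\gamma/2}}{(-\mu+1)_{\gamma/2}}\,e^{-\lambda\mu/2}\,(1-e^{-\lambda})^{\frac12\gamma+1}\;{}_2F_1\!\left[{\tfrac12\gamma+\mu+1,\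 \tfrac12\gamma+1\atop\mu+1};e^{-\lambda}\right].$$ -/

import Mathlib

open scoped TensorProduct

noncomputable section

namespace SlTwo

/-! ### The Lie algebra `sl(2,ℂ)` and modules over it -/

/-- The Lie algebra `sl(2,ℂ)` of traceless `2 × 2` matrices. -/
abbrev sl2 : Type := LieAlgebra.SpecialLinear.sl (Fin 2) ℂ

/-- `e = (0 1; 0 0)`. -/
def e : sl2 := ⟨!![0, 1; 0, 0], by simp [LieAlgebra.SpecialLinear.sl, Matrix.trace_fin_two]⟩

/-- `h = (1 0; 0 -1)`. -/
def h : sl2 := ⟨!![1, 0; 0, -1], by simp [LieAlgebra.SpecialLinear.sl, Matrix.trace_fin_two]⟩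

/-- `f = (0 0; 1 0)`. -/
def f : sl2 := ⟨!![0, 0; 1, 0], by simp [LieAlgebra.SpecialLinear.sl, Matrix.trace_fin_two]⟩

/-- The universal enveloping algebra `U(sl(2,ℂ))`. -/
abbrev U : Type := UniversalEnvelopingAlgebra ℂ sl2

theorem sl2_add_val (A B : sl2) : (A + B).1 = A.1 + B.1 := rfl

theorem sl2_smul_val (t : ℂ) (A : sl2) : (t • A).1 = t • A.1 := rfl

theorem sl2_apply_one_one (A : sl2) : A.1 1 1 = -A.1 0 0 := by
  have hA : Matrix.trace A.1 = 0 := by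
    have := A.2
    simpa [LieAlgebra.SpecialLinear.sl] using this
  rw [Matrix.trace_fin_two] at hA
  exact eq_neg_of_add_eq_zero_right hA

section Triple

variable {M : Type*} [AddCommGroup M] [Module ℂ M]

/-- The action of the matrix `A = a h + b e + c f` when `h`, `e`, `f` act by `H`, `E`, `F`. -/
def tripleAct (H E F : Module.End ℂ M) (A : sl2) : Module.End ℂ M :=
  A.1 0 0 • H + A.1 0 1 • E + A.1 1 0 • F

/-- Operators with `[H,E] = 2E`, `[H,F] = -2F`, `[E,F] = H` make `M` an `sl(2,ℂ)`-module. -/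
@[reducible]
def tripleLieRingModule (H E F : Module.End ℂ M) (hHE : H * E - E * H = (2 : ℂ) • E)
    (hHF : H * F - F * H = (-2 : ℂ) • F) (hEF : E * F - F * E = H) : LieRingModule sl2 M where
  bracket A m := tripleAct H E F A m
  add_lie A B m := by
    simp only [tripleAct, LinearMap.add_apply, LinearMap.smul_apply, sl2_add_val,
      Matrix.add_apply, add_smul]
    abel
  lie_add A m n := map_add _ _ _
  leibniz_lie A B m := by
    have h1 : H (E m) = E (H m) + (2 : ℂ) • E m := by
      rw [← LinearMap.smul_apply, ← hHE]; simp
    have h2 : H (F m) = F (H m) + (-2 : ℂ) • F m := by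
      rw [← LinearMap.smul_apply, ← hHF]; simp
    have h3 : E (F m) = F (E m) + H m := by
      have h4 := LinearMap.congr_fun hEF m
      simp only [LinearMap.sub_apply, Module.End.mul_apply] at h4
      rw [← h4]; abel
    have a1 := sl2_apply_one_one A
    have b1 := sl2_apply_one_one B
    simp only [tripleAct, LinearMap.add_apply, LinearMap.smul_apply, map_add, map_smul,
      LieAlgebra.SpecialLinear.sl_bracket, Matrix.sub_apply, Matrix.mul_apply, Fin.sum_univ_two,
      h1, h2, h3, a1, b1]
    module

end Triple

section Modules

variable (V : Type*) [AddCommGroup V] [Module ℂ V] [LieRingModule sl2 V] [LieModule ℂ sl2 V]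

/-- The weight space `V[β]`, where `𝔥^*` is identified with `ℂ` by evaluation at `h`. -/
def wtSpace (β : ℂ) : Submodule ℂ V :=
  Module.End.eigenspace (LieModule.toEnd ℂ sl2 V h) β

variable {V} in
theorem mem_wtSpace {β : ℂ} {v : V} : v ∈ wtSpace V β ↔ ⁅h, v⁆ = β • v := by
  simp [wtSpace]

end Modules

/-! ### Verma modules -/

/-- The Verma module `M_a`: its basis vector `n` stands for `fⁿ · x_a`. -/
def Verma (_a : ℂ) : Type := ℕ →₀ ℂ

namespace Verma

variable (a : ℂ)

instance : AddCommGroup (Verma a) := inferInstanceAs (AddCommGroup (ℕ →₀ ℂ))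

instance : Module ℂ (Verma a) := inferInstanceAs (Module ℂ (ℕ →₀ ℂ))

/-- The basis `(fⁿ · x_a)_{n ≥ 0}` of `M_a`. -/
def basis : Module.Basis ℕ ℂ (Verma a) := Finsupp.basisSingleOne (R := ℂ) (ι := ℕ)

/-- `h fⁿ x_a = (a - 2n) fⁿ x_a`. -/
def opH : Module.End ℂ (Verma a) :=
  (basis a).constr ℂ fun n => (a - 2 * n) • basis a n

/-- `e fⁿ x_a = n (a - n + 1) fⁿ⁻¹ x_a`, which is `0` for `n = 0`. -/
def opE : Module.End ℂ (Verma a) :=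
  (basis a).constr ℂ fun n => ((n : ℂ) * (a - n + 1)) • basis a (n - 1)

/-- `f fⁿ x_a = fⁿ⁺¹ x_a`. -/
def opF : Module.End ℂ (Verma a) :=
  (basis a).constr ℂ fun n => basis a (n + 1)

theorem opH_basis (n : ℕ) : opH a (basis a n) = (a - 2 * n) • basis a n := by
  simp [opH, Module.Basis.constr_basis]

theorem opE_basis (n : ℕ) :
    opE a (basis a n) = ((n : ℂ) * (a - n + 1)) • basis a (n - 1) := by
  simp [opE, Module.Basis.constr_basis]

theorem opF_basis (n : ℕ) : opF a (basis a n) = basis a (n + 1) := by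
  simp [opF, Module.Basis.constr_basis]

instance : LieRingModule sl2 (Verma a) :=
  tripleLieRingModule (opH a) (opE a) (opF a)
    (by
      refine (basis a).ext fun n => ?_
      simp only [LinearMap.sub_apply, Module.End.mul_apply, LinearMap.smul_apply, opH_basis,
        opE_basis, map_smul]
      rcases n with _ | n
      · simp
      · push_cast
        module)
    (by
      refine (basis a).ext fun n => ?_
      simp only [LinearMap.sub_apply, Module.End.mul_apply, LinearMap.smul_apply, opH_basis,
        opF_basis, map_smul]
      push_cast
      module)
    (by
      refine (basis a).ext fun n => ?_
      simp only [LinearMap.sub_apply, Module.End.mul_apply, opH_basis, opE_basis,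
        opF_basis, map_smul]
      rcases n with _ | n
      · simp
      · push_cast
        module)

instance : LieModule ℂ sl2 (Verma a) where
  smul_lie t A m := by
    change tripleAct _ _ _ (t • A) m = t • tripleAct _ _ _ A m
    simp only [tripleAct, LinearMap.add_apply, LinearMap.smul_apply, sl2_smul_val,
      Matrix.smul_apply, smul_eq_mul, mul_smul, smul_add]
  lie_smul t A m := map_smul _ _ _

/-- The highest weight vector `x_a`. -/
def hwv : Verma a := basis a 0

theorem lie_e_hwv : ⁅e, hwv a⁆ = 0 := by
  change tripleAct _ _ _ e (hwv a) = 0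
  simp [tripleAct, e, hwv, opE_basis]

theorem lie_h_hwv : ⁅h, hwv a⁆ = a • hwv a := by
  change tripleAct _ _ _ h (hwv a) = _
  simp [tripleAct, h, hwv, opH_basis]

theorem lie_f_basis (n : ℕ) : ⁅f, basis a n⁆ = basis a (n + 1) := by
  change tripleAct _ _ _ f (basis a n) = _
  simp [tripleAct, f, opF_basis]

end Verma

/-! ### The finite dimensional irreducible modules -/

/-- The irreducible module `V_γ` of highest weight `γ` (dimension `γ + 1`). -/
def Irrep (γ : ℕ) : Type := Fin (γ + 1) → ℂ

namespace Irrep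

variable (γ : ℕ)

instance : AddCommGroup (Irrep γ) := inferInstanceAs (AddCommGroup (Fin (γ + 1) → ℂ))

instance : Module ℂ (Irrep γ) := inferInstanceAs (Module ℂ (Fin (γ + 1) → ℂ))

/-- The basis of `V_γ`; the vector with index `k` is the weight vector `v^γ_{-γ+2k}`. -/
def basis : Module.Basis (Fin (γ + 1)) ℂ (Irrep γ) := Pi.basisFun ℂ (Fin (γ + 1))

instance : FiniteDimensional ℂ (Irrep γ) := Module.Basis.finiteDimensional_of_finite (basis γ)

/-- The vector `v^γ_{-γ+2k}`, extended by `0` to indices `k > γ`. -/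
def vec (k : ℕ) : Irrep γ := if hk : k < γ + 1 then basis γ ⟨k, hk⟩ else 0

/-- `h v_{-γ+2k} = (-γ+2k) v_{-γ+2k}`. -/
def opH : Module.End ℂ (Irrep γ) :=
  (basis γ).constr ℂ fun k => (-(γ : ℂ) + 2 * (k : ℕ)) • vec γ k

/-- `e v_{-γ+2k} = (γ-k) v_{-γ+2k+2}`, which is `0` for `k = γ`. -/
def opE : Module.End ℂ (Irrep γ) :=
  (basis γ).constr ℂ fun k => ((γ : ℂ) - (k : ℕ)) • vec γ (k + 1)

/-- `f v_{-γ+2k} = k v_{-γ+2k-2}`, which is `0` for `k = 0`. -/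
def opF : Module.End ℂ (Irrep γ) :=
  (basis γ).constr ℂ fun k => ((k : ℕ) : ℂ) • vec γ (k - 1)

theorem basis_eq_vec (k : Fin (γ + 1)) : basis γ k = vec γ k := by
  simp [vec, k.2]

theorem vec_of_lt {k : ℕ} (hk : γ < k) : vec γ k = 0 := by
  simp [vec, show ¬ k < γ + 1 by omega]

theorem opH_vec (k : ℕ) : opH γ (vec γ k) = (-(γ : ℂ) + 2 * k) • vec γ k := by
  by_cases hk : k < γ + 1
  · have : vec γ k = basis γ ⟨k, hk⟩ := by simp [vec, hk]
    rw [this, opH, Module.Basis.constr_basis, ← this]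
  · rw [vec_of_lt γ (by omega)]; simp

theorem opE_vec (k : ℕ) : opE γ (vec γ k) = ((γ : ℂ) - k) • vec γ (k + 1) := by
  by_cases hk : k < γ + 1
  · have : vec γ k = basis γ ⟨k, hk⟩ := by simp [vec, hk]
    rw [this, opE, Module.Basis.constr_basis]
  · rw [vec_of_lt γ (by omega), vec_of_lt γ (by omega)]; simp

theorem opF_vec {k : ℕ} (hk : k ≤ γ) : opF γ (vec γ k) = (k : ℂ) • vec γ (k - 1) := by
  have : vec γ k = basis γ ⟨k, by omega⟩ := by simp [vec, show k < γ + 1 by omega]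
  rw [this, opF, Module.Basis.constr_basis]

instance : LieRingModule sl2 (Irrep γ) :=
  tripleLieRingModule (opH γ) (opE γ) (opF γ)
    (by
      refine (basis γ).ext fun k => ?_
      simp only [basis_eq_vec, LinearMap.sub_apply, Module.End.mul_apply, LinearMap.smul_apply,
        opH_vec, opE_vec, map_smul]
      push_cast
      module)
    (by
      refine (basis γ).ext fun k => ?_
      have hk : (k : ℕ) ≤ γ := by omega
      simp only [basis_eq_vec, LinearMap.sub_apply, Module.End.mul_apply, LinearMap.smul_apply,
        opH_vec, opF_vec γ hk, map_smul]
      rcases (k : ℕ) with _ | n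
      · simp
      · push_cast
        module)
    (by
      refine (basis γ).ext fun k => ?_
      have hk : (k : ℕ) ≤ γ := by omega
      simp only [basis_eq_vec, LinearMap.sub_apply, Module.End.mul_apply,
        opH_vec, opF_vec γ hk, opE_vec, map_smul]
      generalize (k : ℕ) = n at hk
      rcases hk.eq_or_lt with rfl | hk'
      · rcases n with _ | n
        · simp
        · push_cast
          module
      · rw [opF_vec γ (by omega)]
        rcases n with _ | n
        · push_cast
          module
        · push_cast
          module)

instance : LieModule ℂ sl2 (Irrep γ) where
  smul_lie t A m := by
    change tripleAct _ _ _ (t • A) m = t • tripleAct _ _ _ A m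
    simp only [tripleAct, LinearMap.add_apply, LinearMap.smul_apply, sl2_smul_val,
      Matrix.smul_apply, smul_eq_mul, mul_smul, smul_add]
  lie_smul t A m := map_smul _ _ _

theorem lie_h_vec (k : ℕ) : ⁅h, vec γ k⁆ = (-(γ : ℂ) + 2 * k) • vec γ k := by
  change tripleAct _ _ _ h (vec γ k) = _
  simp [tripleAct, h, opH_vec]

theorem lie_e_vec (k : ℕ) : ⁅e, vec γ k⁆ = ((γ : ℂ) - k) • vec γ (k + 1) := by
  change tripleAct _ _ _ e (vec γ k) = _
  simp [tripleAct, e, opE_vec]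

theorem lie_f_vec {k : ℕ} (hk : k ≤ γ) : ⁅f, vec γ k⁆ = (k : ℂ) • vec γ (k - 1) := by
  change tripleAct _ _ _ f (vec γ k) = _
  simp [tripleAct, f, opF_vec γ hk]

/-- For even `γ`, the zero weight vector `v^γ_0`. -/
def zeroVec : Irrep γ := vec γ (γ / 2)

/-- For even `γ`, the zero weight functional `(v^γ_0)^*` in `V_γ^*[0]`: the coordinate at `v^γ_0`. -/
def zeroCovec (hγ : Even γ) : wtSpace (Module.Dual ℂ (Irrep γ)) 0 :=
  ⟨(basis γ).coord ⟨γ / 2, by omega⟩, by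
    obtain ⟨m, rfl⟩ := hγ
    rw [mem_wtSpace, zero_smul]
    refine (basis (m + m)).ext fun k => ?_
    rw [Module.Dual.lie_apply, LinearMap.zero_apply]
    rw [show ⁅h, basis (m + m) k⁆ = (-((m + m : ℕ) : ℂ) + 2 * (k : ℕ)) • basis (m + m) k by
      rw [basis_eq_vec]; exact lie_h_vec _ _]
    rw [map_smul, Module.Basis.coord_apply, Module.Basis.repr_self, neg_eq_zero, smul_eq_mul,
      mul_eq_zero, Finsupp.single_apply]
    by_cases hk : k = ⟨(m + m) / 2, by omega⟩
    · left
      rw [hk]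
      have : (m + m) / 2 = m := by omega
      simp only [this]
      push_cast
      ring
    · right
      rw [if_neg hk]⟩

end Irrep

/-! ### Intertwining operators -/

/-- The sum of the weight spaces `M_b[ν]` over all `ν < b`, that is over `ν = b - 2(n+1)`,
`n = 0, 1, 2, …`. -/
def Verma.lower (b : ℂ) : Submodule ℂ (Verma b) :=
  ⨆ n : ℕ, wtSpace (Verma b) (b - 2 * ((n : ℂ) + 1))

section Intertwiner

variable {V : Type*} [AddCommGroup V] [Module ℂ V] [LieRingModule sl2 V] [LieModule ℂ sl2 V]

/-- For `v` of weight `a - b`: the `𝔤`-intertwining operator `Φ : M_a → M_b ⊗ V` satisfies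
`Φ(x_a) ∈ x_b ⊗ v + ⨁_{ν < b} M_b[ν] ⊗ V`. -/
def IsIntertwiner (a b : ℂ) (v : V) (Φ : Verma a →ₗ⁅ℂ, sl2⁆ Verma b ⊗[ℂ] V) : Prop :=
  Φ (Verma.hwv a) - Verma.hwv b ⊗ₜ[ℂ] v ∈
    LinearMap.range (LinearMap.rTensor V (Verma.lower b).subtype)

open Classical in
/-- The intertwining operator `Φ_a^v : M_a → M_b ⊗ V`, for `v ∈ V[a - b]`
(junk value `0` if it does not exist uniquely). -/
def intertwiner (a b : ℂ) (v : V) : Verma a →ₗ⁅ℂ, sl2⁆ Verma b ⊗[ℂ] V :=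
  if H : ∃! Φ, IsIntertwiner a b v Φ then H.choose else 0

end Intertwiner

/-! ### The fusion matrix -/

section Fusion

variable {W : Type*} [AddCommGroup W] [Module ℂ W] [LieRingModule sl2 W] [LieModule ℂ sl2 W]
variable {V : Type*} [AddCommGroup V] [Module ℂ V] [LieRingModule sl2 V] [LieModule ℂ sl2 V]

/-- For `v ∈ V[a - b]` and `w ∈ W[b - c]`: the vector `j ∈ W ⊗ V` has weight `a - c` and satisfies
`(Φ_b^w ⊗ 1)(Φ_a^v(x_a)) = Φ_a^j(x_a)`. -/
def IsFusion (a b c : ℂ) (w : W) (v : V) (j : W ⊗[ℂ] V) : Prop :=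
  j ∈ wtSpace (W ⊗[ℂ] V) (a - c) ∧
    TensorProduct.assoc ℂ (Verma c) W V
      (LinearMap.rTensor V (intertwiner b c w : Verma b →ₗ[ℂ] Verma c ⊗[ℂ] W)
        (intertwiner a b v (Verma.hwv a))) =
      intertwiner a c j (Verma.hwv a)

open Classical in
/-- The value `J_{WV}(a)(w ⊗ v)` of the fusion matrix, for `v ∈ V[a - b]` and `w ∈ W[b - c]`
(junk value `0` if it is not uniquely determined). -/
def fusion (a b c : ℂ) (w : W) (v : V) : W ⊗[ℂ] V :=
  if H : ∃! j, IsFusion a b c w v j then H.choose else 0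

end Fusion

/-! ### The antipode of `U(sl(2,ℂ))` -/

section Antipode

attribute [local instance] LieRing.ofAssociativeRing

/-- The antipode of `U(𝔤)` as a homomorphism to the opposite algebra; it sends `x ∈ 𝔤` to `-x`. -/
def antipodeHom : U →ₐ[ℂ] Uᵐᵒᵖ :=
  UniversalEnvelopingAlgebra.lift ℂ
    { toFun := fun x => MulOpposite.op (-UniversalEnvelopingAlgebra.ι ℂ x)
      map_add' := fun x y => by
        rw [map_add, neg_add, MulOpposite.op_add]
      map_smul' := fun t x => by
        rw [map_smul, ← smul_neg, MulOpposite.op_smul, RingHom.id_apply]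
      map_lie' := fun {x y} => by
        rw [LieHom.map_lie, LieRing.of_associative_ring_bracket,
          LieRing.of_associative_ring_bracket, ← MulOpposite.op_mul, ← MulOpposite.op_mul,
          ← MulOpposite.op_sub]
        congr 1
        noncomm_ring }

theorem antipodeHom_ι (x : sl2) :
    antipodeHom (UniversalEnvelopingAlgebra.ι ℂ x) =
      MulOpposite.op (-UniversalEnvelopingAlgebra.ι ℂ x) :=
  UniversalEnvelopingAlgebra.lift_ι_apply ℂ _ x

theorem antipodeHom_antipodeHom (x : U) :
    (antipodeHom (antipodeHom x).unop).unop = x := by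
  let g : U →ₐ[ℂ] U := AlgHom.ofLinearMap
    ((MulOpposite.opLinearEquiv ℂ).symm.toLinearMap ∘ₗ antipodeHom.toLinearMap ∘ₗ
      (MulOpposite.opLinearEquiv ℂ).symm.toLinearMap ∘ₗ antipodeHom.toLinearMap)
    (by simp) (by intro a b; simp)
  have hg : g = AlgHom.id ℂ U := by
    apply UniversalEnvelopingAlgebra.hom_ext
    ext y
    change (antipodeHom (antipodeHom (UniversalEnvelopingAlgebra.ι ℂ y)).unop).unop =
      UniversalEnvelopingAlgebra.ι ℂ y
    rw [antipodeHom_ι, MulOpposite.unop_op, map_neg, antipodeHom_ι]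
    simp
  exact DFunLike.congr_fun hg x

/-- The antipode `S` of `U(𝔤)`, as a linear bijection. -/
def antipode : U ≃ₗ[ℂ] U where
  toFun x := (antipodeHom x).unop
  invFun x := (antipodeHom x).unop
  map_add' x y := by simp
  map_smul' t x := by simp
  left_inv x := antipodeHom_antipodeHom x
  right_inv x := antipodeHom_antipodeHom x

end Antipode

/-! ### The operator `Q` -/

section Q

/-- The action of `U(𝔤)` on a `𝔤`-module. -/
def actU (V : Type*) [AddCommGroup V] [Module ℂ V] [LieRingModule sl2 V] [LieModule ℂ sl2 V] :
    U →ₐ[ℂ] Module.End ℂ V :=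
  UniversalEnvelopingAlgebra.lift ℂ (LieModule.toEnd ℂ sl2 V)

/-- The action of `U(𝔤) ⊗ U(𝔤)` on `W ⊗ V`. -/
def actUU (W V : Type*) [AddCommGroup W] [Module ℂ W] [LieRingModule sl2 W] [LieModule ℂ sl2 W]
    [AddCommGroup V] [Module ℂ V] [LieRingModule sl2 V] [LieModule ℂ sl2 V] :
    U ⊗[ℂ] U →ₗ[ℂ] Module.End ℂ (W ⊗[ℂ] V) :=
  TensorProduct.homTensorHomMap (.id ℂ) W V W V ∘ₗ
    TensorProduct.map (actU W).toLinearMap (actU V).toLinearMap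

/-- The map `m ∘ P ∘ (1 ⊗ S⁻¹) : U(𝔤) ⊗ U(𝔤) → U(𝔤)`, where `P` is the flip and `m` the
multiplication. -/
def contraction : U ⊗[ℂ] U →ₗ[ℂ] U :=
  LinearMap.mul' ℂ U ∘ₗ (TensorProduct.comm ℂ U U).toLinearMap ∘ₗ
    LinearMap.lTensor U antipode.symm.toLinearMap

variable (V : Type*) [AddCommGroup V] [Module ℂ V] [LieRingModule sl2 V] [LieModule ℂ sl2 V]

/-- `q` is the restriction to `V[0]` of the action on `V` of
`Q(a) = (m ∘ P ∘ (1 ⊗ S⁻¹)) J(a)`.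

The universal fusion matrix `J(a)` is a generalized element of `U(𝔤) ⊗ U(𝔤)`: it acts on `W ⊗ V`
as `J_{WV}(a)`, and on any given vector it acts as some honest element `X` of `U(𝔤) ⊗ U(𝔤)`.
For `X = ∑ x_i ⊗ y_i` the matrix coefficient `φ((m ∘ P ∘ (1 ⊗ S⁻¹)) X · u) = ∑ φ(S⁻¹(y_i) x_i u)` is
`∑ (y_i φ)(x_i u)`, so it only depends on `X · (u ⊗ φ) ∈ V ⊗ V^*`. Hence the coefficient
`φ(Q(a) u)` is computed from any `X` which agrees with `J(a)` on `u ⊗ φ`. As `Q(a)` preserves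
weights, its restriction to `V[0]` is determined by these coefficients with `φ ∈ V^*[0]`. -/
def IsQZero (a : ℂ) (q : Module.End ℂ (wtSpace V 0)) : Prop :=
  ∀ (u : wtSpace V 0) (φ : wtSpace (Module.Dual ℂ V) 0), ∃ X : U ⊗[ℂ] U,
    actUU V (Module.Dual ℂ V) X (u.1 ⊗ₜ[ℂ] φ.1) = fusion a a a u.1 φ.1 ∧
      φ.1 (q u).1 = φ.1 (actU V (contraction X) u.1)

open Classical in
/-- The operator `Q_V(a)` on `V[0]` (junk value `0` if it is not uniquely determined). -/
def QZero (a : ℂ) : Module.End ℂ (wtSpace V 0) :=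
  if H : ∃! q, IsQZero V a q then H.choose else 0

end Q

/-! ### Weighted trace functions -/

/-- The bilinear form `⟨l, m⟩ = l m / 2` on `𝔥^* = ℂ`. -/
def pairing (l m : ℂ) : ℂ := l * m / 2

/-- Half the sum of the positive roots; the only positive root is `2`. -/
def rho : ℂ := 1

/-- The Weyl denominator `δ(l) = e^{⟨l, ρ⟩} (1 - e^{-⟨l, 2⟩})`. -/
def weylDenominator (l : ℂ) : ℂ :=
  Complex.exp (pairing l rho) * (1 - Complex.exp (-pairing l 2))

/-- The operator `exp_l` on `M_a`: it multiplies the vector `fⁿ x_a`, of weight `a - 2n`, by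
`e^{⟨l, a - 2n⟩}`. -/
def expVerma (l a : ℂ) : Module.End ℂ (Verma a) :=
  (Verma.basis a).constr ℂ fun n => Complex.exp (pairing l (a - 2 * n)) • Verma.basis a n

/-- Convergence of a series in a finite dimensional space `X`, tested by linear functionals. -/
def HasSumWeak {X : Type*} [AddCommGroup X] [Module ℂ X] (s : ℕ → X) (x : X) : Prop :=
  ∀ ψ : Module.Dual ℂ X, HasSum (fun n => ψ (s n)) (ψ x)

open Classical in
/-- The sum of a series in a finite dimensional space `X` (junk value `0` if it diverges). -/
def sumWeak {X : Type*} [AddCommGroup X] [Module ℂ X] (s : ℕ → X) : X :=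
  if H : ∃ x, HasSumWeak s x then H.choose else 0

/-- The `n`-th diagonal entry, in `X`, of a map `T : M_a → M_a ⊗ X` with respect to the basis
`(fⁿ x_a)_n` of weight vectors. -/
def diagEntry {a : ℂ} {X : Type*} [AddCommGroup X] [Module ℂ X]
    (T : Verma a →ₗ[ℂ] Verma a ⊗[ℂ] X) (n : ℕ) : X :=
  TensorProduct.lid ℂ X (LinearMap.rTensor X ((Verma.basis a).coord n) (T (Verma.basis a n)))

/-- The trace over `M_a` of a map `T : M_a → M_a ⊗ X`, an element of `X`. -/
def vermaTrace {a : ℂ} {X : Type*} [AddCommGroup X] [Module ℂ X]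
    (T : Verma a →ₗ[ℂ] Verma a ⊗[ℂ] X) : X :=
  sumWeak (diagEntry T)

section WeightedTrace

variable {V : Type*} [AddCommGroup V] [Module ℂ V] [LieRingModule sl2 V] [LieModule ℂ sl2 V]
variable {ι : Type*} [Fintype ι] [DecidableEq ι]

/-- The vectors `B* i ∈ V^*[0]` form the dual basis of the basis `B` of `V[0]`. -/
def IsDualBasis (B : Module.Basis ι ℂ (wtSpace V 0))
    (Bd : ι → wtSpace (Module.Dual ℂ V) 0) : Prop :=
  ∀ i j, (Bd i).1 (B j).1 = if i = j then 1 else 0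

/-- `Φ_a^{V[0]} = ∑_{v ∈ B[0]} Φ_a^v ⊗ v^* : M_a → M_a ⊗ (V ⊗ V^*[0])`. -/
def zeroIntertwiner (a : ℂ) (B : Module.Basis ι ℂ (wtSpace V 0))
    (Bd : ι → wtSpace (Module.Dual ℂ V) 0) :
    Verma a →ₗ[ℂ] Verma a ⊗[ℂ] (V ⊗[ℂ] wtSpace (Module.Dual ℂ V) 0) :=
  ∑ i, (TensorProduct.assoc ℂ (Verma a) V (wtSpace (Module.Dual ℂ V) 0)).toLinearMap ∘ₗ
    (TensorProduct.mk ℂ (Verma a ⊗[ℂ] V) (wtSpace (Module.Dual ℂ V) 0)).flip (Bd i) ∘ₗ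
      (intertwiner a a (B i).1 : Verma a →ₗ[ℂ] Verma a ⊗[ℂ] V)

/-- `Ψ_V(l, a) = Tr_{M_a}(Φ_a^{V[0]} ∘ exp_l)`. -/
def Psi (l a : ℂ) (B : Module.Basis ι ℂ (wtSpace V 0))
    (Bd : ι → wtSpace (Module.Dual ℂ V) 0) : V ⊗[ℂ] wtSpace (Module.Dual ℂ V) 0 :=
  vermaTrace (zeroIntertwiner a B Bd ∘ₗ expVerma l a)

/-- The weighted trace function
`F_V(l, m) = δ(l) (id_V ⊗ Q_{V^*}(-m-ρ)⁻¹) Ψ_V(l, -m-ρ)`. -/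
def weightedTrace (l m : ℂ) (B : Module.Basis ι ℂ (wtSpace V 0))
    (Bd : ι → wtSpace (Module.Dual ℂ V) 0) : V ⊗[ℂ] wtSpace (Module.Dual ℂ V) 0 :=
  weylDenominator l •
    LinearMap.lTensor V (Ring.inverse (QZero (Module.Dual ℂ V) (-m - rho)))
      (Psi l (-m - rho) B Bd)

end WeightedTrace

end SlTwo
end

open scoped TensorProduct

noncomputable section

namespace SlTwo

/-! ### Relations in `sl(2,ℂ)` and weight vectors -/

/-! Write a = -μ - 1 and γ = 2m. The condition μ ∉ {-1, -2, …} says that a is not a natural number.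
Comparing coefficients of fⁿ x_a in e·t = 0 for t ∈ M_a ⊗ V then gives a recursion with nonzero
factors (n+1)(a-n), so t is determined by its coefficient at x_a (`eq_of_lie_e_eq_zero`). For v of
weight zero the solution is ∑ cₙ fⁿ x_a ⊗ eⁿ v with cₙ = 1/(n! (-a)_n). This yields the intertwining
operators. Taking the coefficient at x_a of a composition gives J(a)(w ⊗ v) = ∑ cₙ fⁿ w ⊗ eⁿ v
(`fusion_eq_sum`).

On the line V_γ[0] the operator fⁿ eⁿ is a scalar, and cₙ times that scalar is (-1)ⁿ times the n-th
coefficient of ₂F₁(-m, m+1; μ+1; ·) (`Irrep.intertwinerCoeff_mul_zeroEigenvalue`). The same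
polynomial therefore governs both ingredients of the trace function. Its value at 1 is the scalar Q,
which Chu–Vandermonde evaluates as (-1)^m (1-μ)_m / (μ+1)_m; this is nonzero because μ ∉ {1, …, m},
and its inverse is the prefactor.

For the trace put q = e^{-λ}. The n-th diagonal entry is a binomial sum of these coefficients, and
∑ₙ C(n,j) qⁿ = q^j/(1-q)^{j+1} turns the series into (1-q)⁻¹ ₂F₁(-m, m+1; μ+1; -q/(1-q)). The Weyl
denominator removes (1-q)⁻¹, and -q/(1-q) = (1-e^λ)⁻¹. The second formula is Pfaff's transformation
(`hypergeometric_pfaff`), again a consequence of Chu–Vandermonde. -/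

theorem lie_h_e : ⁅h, e⁆ = (2 : ℂ) • e := by
  apply Subtype.ext
  rw [LieAlgebra.SpecialLinear.sl_bracket, sl2_smul_val]
  ext i j
  fin_cases i <;> fin_cases j <;> norm_num [h, e]

theorem lie_h_f : ⁅h, f⁆ = (-2 : ℂ) • f := by
  apply Subtype.ext
  rw [LieAlgebra.SpecialLinear.sl_bracket, sl2_smul_val]
  ext i j
  fin_cases i <;> fin_cases j <;> norm_num [h, f]

theorem lie_e_f : ⁅e, f⁆ = h := by
  apply Subtype.ext
  rw [LieAlgebra.SpecialLinear.sl_bracket]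
  ext i j
  fin_cases i <;> fin_cases j <;> norm_num [h, e, f]

theorem sl2_eq_combination (A : sl2) : A = A.1 0 0 • h + A.1 0 1 • e + A.1 1 0 • f := by
  have h11 := sl2_apply_one_one A
  apply Subtype.ext
  rw [sl2_add_val, sl2_add_val, sl2_smul_val, sl2_smul_val, sl2_smul_val]
  ext i j
  fin_cases i <;> fin_cases j <;> simp [h, e, f, h11]

section LieModule

variable {M : Type*} [AddCommGroup M] [Module ℂ M] [LieRingModule sl2 M] [LieModule ℂ sl2 M]

/-- The action of `eⁿ` on a module. -/
def powE (M : Type*) [AddCommGroup M] [Module ℂ M] [LieRingModule sl2 M] [LieModule ℂ sl2 M]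
    (n : ℕ) : Module.End ℂ M := LieModule.toEnd ℂ sl2 M e ^ n

/-- The action of `fⁿ` on a module. -/
def powF (M : Type*) [AddCommGroup M] [Module ℂ M] [LieRingModule sl2 M] [LieModule ℂ sl2 M]
    (n : ℕ) : Module.End ℂ M := LieModule.toEnd ℂ sl2 M f ^ n

@[simp] theorem powE_zero (m : M) : powE M 0 m = m := by simp [powE]

@[simp] theorem powF_zero (m : M) : powF M 0 m = m := by simp [powF]

theorem powE_succ (n : ℕ) (m : M) : powE M (n + 1) m = ⁅e, powE M n m⁆ := by
  simp [powE, pow_succ']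

theorem powF_succ (n : ℕ) (m : M) : powF M (n + 1) m = ⁅f, powF M n m⁆ := by
  simp [powF, pow_succ']

theorem lie_h_powE {β : ℂ} {m : M} (hm : ⁅h, m⁆ = β • m) (n : ℕ) :
    ⁅h, powE M n m⁆ = (β + 2 * n) • powE M n m := by
  induction n with
  | zero => simpa using hm
  | succ n ih =>
    rw [powE_succ, leibniz_lie, lie_h_e, ih, lie_smul, smul_lie]
    push_cast
    module

theorem lie_h_powF {β : ℂ} {m : M} (hm : ⁅h, m⁆ = β • m) (n : ℕ) :
    ⁅h, powF M n m⁆ = (β - 2 * n) • powF M n m := by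
  induction n with
  | zero => simpa using hm
  | succ n ih =>
    rw [powF_succ, leibniz_lie, lie_h_f, ih, lie_smul, smul_lie]
    push_cast
    module

theorem lie_e_powF {a : ℂ} {m : M} (he : ⁅e, m⁆ = 0) (hm : ⁅h, m⁆ = a • m) (n : ℕ) :
    ⁅e, powF M n m⁆ = ((n : ℂ) * (a - n + 1)) • powF M (n - 1) m := by
  induction n with
  | zero => simpa using he
  | succ n ih =>
    rw [powF_succ, leibniz_lie, lie_e_f, ih, lie_smul, lie_h_powF hm]
    rcases n with _ | n
    · simp
    · rw [Nat.add_sub_cancel, ← powF_succ, Nat.add_sub_cancel]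
      push_cast
      module

/-- Vectors of pairwise distinct weights in a finite dimensional module, one for each natural
number below some `N` larger than the dimension, cannot all be nonzero. -/
theorem exists_eq_zero_of_distinct_weights [FiniteDimensional ℂ M] {N : ℕ}
    (hN : Module.finrank ℂ M < N) (x : ℕ → M) (β : ℕ → ℂ) (hβ : Function.Injective β)
    (hx : ∀ n, ⁅h, x n⁆ = β n • x n) : ∃ n < N, x n = 0 := by
  by_contra! hne
  have hli : LinearIndependent ℂ (fun i : Fin N => x i) :=
    Module.End.eigenvectors_linearIndependent' (LieModule.toEnd ℂ sl2 M h)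
      (fun i : Fin N => β i) (hβ.comp Fin.val_injective) _
      (fun i => Module.End.hasEigenvector_iff.2
        ⟨Module.End.mem_eigenspace_iff.2 (hx i), hne i i.2⟩)
  have := hli.fintype_card_le_finrank
  rw [Fintype.card_fin] at this
  omega

/-- The vectors eⁿ m have distinct weights, so one with n < N vanishes, and then so do all later
ones. The cutoff depends only on the dimension, which lets the infinite sums over n be truncated
uniformly. -/
theorem powE_eq_zero [FiniteDimensional ℂ M] {β : ℂ} {m : M} (hm : ⁅h, m⁆ = β • m) {N : ℕ}
    (hN : Module.finrank ℂ M < N) : powE M N m = 0 := by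
  obtain ⟨n, hn, h0⟩ := exists_eq_zero_of_distinct_weights hN (fun n => powE M n m)
    (fun n => β + 2 * n) (fun i j hij => by simpa using hij) (lie_h_powE hm)
  obtain ⟨k, rfl⟩ := Nat.exists_eq_add_of_lt hn
  have : powE M (n + k + 1) m = powE M (k + 1) (powE M n m) := by
    rw [powE, powE, powE, ← Module.End.mul_apply, ← pow_add]
    congr 2
    ring
  rw [this, h0, map_zero]

end LieModule

/-! ### Maps out of Verma modules -/

namespace Verma

variable {a b : ℂ}

theorem lie_h_basis (n : ℕ) : ⁅h, basis a n⁆ = (a - 2 * n) • basis a n := by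
  change tripleAct _ _ _ h (basis a n) = _
  simp [tripleAct, h, opH_basis]

theorem lie_e_basis (n : ℕ) :
    ⁅e, basis a n⁆ = ((n : ℂ) * (a - n + 1)) • basis a (n - 1) := by
  change tripleAct _ _ _ e (basis a n) = _
  simp [tripleAct, e, opE_basis]

variable {N : Type*} [AddCommGroup N] [Module ℂ N] [LieRingModule sl2 N] [LieModule ℂ sl2 N]

theorem lieHom_basis (Φ : Verma a →ₗ⁅ℂ, sl2⁆ N) (n : ℕ) :
    Φ (basis a n) = powF N n (Φ (hwv a)) := by
  induction n with
  | zero => rw [powF_zero]; rfl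
  | succ n ih => rw [powF_succ, ← ih, ← LieModuleHom.map_lie, lie_f_basis]

theorem lieHom_ext {Φ Φ' : Verma a →ₗ⁅ℂ, sl2⁆ N} (H : Φ (hwv a) = Φ' (hwv a)) : Φ = Φ' := by
  apply LieModuleHom.ext
  intro m
  have : (Φ : Verma a →ₗ[ℂ] N) = (Φ' : Verma a →ₗ[ℂ] N) := by
    refine (basis a).ext fun n => ?_
    change Φ (basis a n) = Φ' (basis a n)
    rw [lieHom_basis, lieHom_basis, H]
  exact LinearMap.congr_fun this m

/-- The universal property of Verma modules. -/
def lift (s : N) (he : ⁅e, s⁆ = 0) (hh : ⁅h, s⁆ = a • s) : Verma a →ₗ⁅ℂ, sl2⁆ N :=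
  { (basis a).constr ℂ fun n => powF N n s with
    map_lie' := by
      intro A m
      set L : Verma a →ₗ[ℂ] N := (basis a).constr ℂ fun n => powF N n s with hL
      have hb : ∀ n, L (basis a n) = powF N n s := fun n => by
        rw [hL, Module.Basis.constr_basis]
      have key : L ∘ₗ LieModule.toEnd ℂ sl2 (Verma a) A = LieModule.toEnd ℂ sl2 N A ∘ₗ L := by
        refine (basis a).ext fun n => ?_
        simp only [LinearMap.comp_apply, LieModule.toEnd_apply_apply]
        rw [hb, sl2_eq_combination A]
        simp only [add_lie, smul_lie, map_add, map_smul, lie_h_basis, lie_e_basis, lie_f_basis, hb,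
          lie_h_powF hh, lie_e_powF he hh, ← powF_succ]
      exact LinearMap.congr_fun key m }

theorem lift_hwv (s : N) (he : ⁅e, s⁆ = 0) (hh : ⁅h, s⁆ = a • s) : lift s he hh (hwv a) = s := by
  change (basis a).constr ℂ (fun n => powF N n s) (basis a 0) = s
  rw [Module.Basis.constr_basis, powF_zero]

end Verma

/-! ### Coefficients of vectors in `M_b ⊗ V` -/

section Coeff

variable {b : ℂ} {V : Type*} [AddCommGroup V] [Module ℂ V]

/-- The coefficient in `V` of `fⁿ x_b` of a vector in `M_b ⊗ V`. -/
def coeff (n : ℕ) : Verma b ⊗[ℂ] V →ₗ[ℂ] V :=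
  (TensorProduct.lid ℂ V).toLinearMap ∘ₗ LinearMap.rTensor V ((Verma.basis b).coord n)

theorem coeff_tmul (n : ℕ) (x : Verma b) (v : V) :
    coeff n (x ⊗ₜ[ℂ] v) = (Verma.basis b).coord n x • v := by
  simp [coeff]

theorem coord_basis (n k : ℕ) :
    (Verma.basis b).coord n (Verma.basis b k) = if k = n then 1 else 0 := by
  rw [Module.Basis.coord_apply, Module.Basis.repr_self, Finsupp.single_apply]

theorem coeff_basis_tmul (n k : ℕ) (v : V) :
    coeff n (Verma.basis b k ⊗ₜ[ℂ] v) = if k = n then v else 0 := by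
  rw [coeff_tmul, coord_basis]
  split_ifs <;> simp

theorem coeff_ext {s t : Verma b ⊗[ℂ] V} (H : ∀ n, coeff n s = coeff n t) : s = t := by
  apply (TensorProduct.equivFinsuppOfBasisLeft (N := V) (Verma.basis b)).injective
  ext n
  rw [TensorProduct.equivFinsuppOfBasisLeft_apply, TensorProduct.equivFinsuppOfBasisLeft_apply]
  exact H n

/-- Two linear maps on `M_b ⊗ V` agree if they do on the vectors `fⁿ x_b ⊗ v`. -/
theorem hom_ext_basis_tmul {X : Type*} [AddCommGroup X] [Module ℂ X]
    {L L' : Verma b ⊗[ℂ] V →ₗ[ℂ] X}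
    (H : ∀ n v, L (Verma.basis b n ⊗ₜ[ℂ] v) = L' (Verma.basis b n ⊗ₜ[ℂ] v)) : L = L' :=
  TensorProduct.ext ((Verma.basis b).ext fun n => LinearMap.ext fun v => H n v)

/-- The coordinate at x_b is an eigenvector of the transpose of h with eigenvalue b, so it kills
every weight space of another weight. -/
theorem coord_zero_of_mem_lower {x : Verma b} (hx : x ∈ Verma.lower b) :
    (Verma.basis b).coord 0 x = 0 := by
  have hle : Verma.lower b ≤ LinearMap.ker ((Verma.basis b).coord 0) := by
    refine iSup_le fun n y hy => ?_
    rw [mem_wtSpace] at hy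
    have hc : (Verma.basis b).coord 0 ∘ₗ LieModule.toEnd ℂ sl2 (Verma b) h =
        b • (Verma.basis b).coord 0 := by
      refine (Verma.basis b).ext fun k => ?_
      simp only [LinearMap.comp_apply, LieModule.toEnd_apply_apply, Verma.lie_h_basis, map_smul,
        LinearMap.smul_apply, coord_basis]
      rcases k with _ | k <;> simp
    have h1 := LinearMap.congr_fun hc y
    simp only [LinearMap.comp_apply, LieModule.toEnd_apply_apply, hy, map_smul,
      LinearMap.smul_apply, smul_eq_mul] at h1
    have h2 : (2 * ((n : ℂ) + 1)) * (Verma.basis b).coord 0 y = 0 := by linear_combination -h1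
    have h3 : (2 * ((n : ℂ) + 1)) ≠ 0 := mul_ne_zero two_ne_zero (Nat.cast_add_one_ne_zero n)
    exact (mul_eq_zero.1 h2).resolve_left h3
  exact hle hx

theorem basis_succ_mem_lower (n : ℕ) : Verma.basis b (n + 1) ∈ Verma.lower b := by
  refine Submodule.mem_iSup_of_mem n (mem_wtSpace.2 ?_)
  rw [Verma.lie_h_basis]
  push_cast
  rfl

theorem mem_range_lower_iff (t : Verma b ⊗[ℂ] V) :
    t ∈ LinearMap.range (LinearMap.rTensor V (Verma.lower b).subtype) ↔ coeff 0 t = 0 := by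
  constructor
  · rintro ⟨s, rfl⟩
    have : coeff 0 ∘ₗ LinearMap.rTensor V (Verma.lower b).subtype = 0 := by
      refine TensorProduct.ext' fun x v => ?_
      rw [LinearMap.comp_apply, LinearMap.rTensor_tmul, coeff_tmul, Submodule.subtype_apply,
        coord_zero_of_mem_lower x.2, zero_smul, LinearMap.zero_apply]
    exact LinearMap.congr_fun this s
  · intro ht
    set R := LinearMap.range (LinearMap.rTensor V (Verma.lower b).subtype)
    -- Modulo the range, every t is congruent to x_b ⊗ `coeff 0 t`.
    have key : R.mkQ ∘ₗ (LinearMap.id - TensorProduct.mk ℂ (Verma b) V (Verma.basis b 0) ∘ₗ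
        coeff 0) = 0 := by
      refine hom_ext_basis_tmul fun n v => ?_
      simp only [LinearMap.comp_apply, LinearMap.sub_apply, LinearMap.id_apply,
        TensorProduct.mk_apply, coeff_basis_tmul, LinearMap.zero_apply, Submodule.mkQ_apply,
        Submodule.Quotient.mk_eq_zero]
      rcases n with _ | n
      · simp
      · simp only [Nat.add_eq_zero_iff, one_ne_zero, and_false, if_false, TensorProduct.tmul_zero,
          sub_zero]
        exact ⟨⟨_, basis_succ_mem_lower n⟩ ⊗ₜ v, by simp⟩
    have h1 := LinearMap.congr_fun key t
    simpa [ht] using h1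

variable [LieRingModule sl2 V] [LieModule ℂ sl2 V]

/-- The recursion behind all uniqueness statements: it expresses `coeff (n + 1)` of a vector killed
by e through `coeff n`, provided b ≠ n. -/
theorem coeff_lie_e (n : ℕ) (t : Verma b ⊗[ℂ] V) :
    coeff n ⁅e, t⁆ = (((n : ℂ) + 1) * (b - n)) • coeff (n + 1) t + ⁅e, coeff n t⁆ := by
  have : coeff n ∘ₗ LieModule.toEnd ℂ sl2 (Verma b ⊗[ℂ] V) e =
      (((n : ℂ) + 1) * (b - n)) • coeff (n + 1) + LieModule.toEnd ℂ sl2 V e ∘ₗ coeff n := by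
    refine hom_ext_basis_tmul fun k v => ?_
    simp only [LinearMap.comp_apply, LinearMap.add_apply, LinearMap.smul_apply,
      LieModule.toEnd_apply_apply, TensorProduct.LieModule.lie_tmul_right, Verma.lie_e_basis,
      map_add, coeff_basis_tmul, ← TensorProduct.smul_tmul', map_smul]
    rcases k with _ | k
    · split_ifs <;> simp_all
    · simp only [Nat.add_sub_cancel, add_left_inj]
      by_cases hk : k = n
      · subst hk
        simp only [if_true]
        split_ifs
        · omega
        · push_cast
          simp only [lie_zero]
          module
      · simp only [hk, if_false, smul_zero, zero_add]
        split_ifs <;> simp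
  exact LinearMap.congr_fun this t

theorem coeff_lie_h (n : ℕ) (t : Verma b ⊗[ℂ] V) :
    coeff n ⁅h, t⁆ = (b - 2 * n) • coeff n t + ⁅h, coeff n t⁆ := by
  have : coeff n ∘ₗ LieModule.toEnd ℂ sl2 (Verma b ⊗[ℂ] V) h =
      (b - 2 * n) • coeff n + LieModule.toEnd ℂ sl2 V h ∘ₗ coeff n := by
    refine hom_ext_basis_tmul fun k v => ?_
    simp only [LinearMap.comp_apply, LinearMap.add_apply, LinearMap.smul_apply,
      LieModule.toEnd_apply_apply, TensorProduct.LieModule.lie_tmul_right, Verma.lie_h_basis,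
      map_add, coeff_basis_tmul, ← TensorProduct.smul_tmul', map_smul]
    by_cases hk : k = n
    · subst hk; simp
    · simp [hk]
  exact LinearMap.congr_fun this t

theorem coeff_zero_lie_f (t : Verma b ⊗[ℂ] V) : coeff 0 ⁅f, t⁆ = ⁅f, coeff 0 t⁆ := by
  have : coeff 0 ∘ₗ LieModule.toEnd ℂ sl2 (Verma b ⊗[ℂ] V) f =
      LieModule.toEnd ℂ sl2 V f ∘ₗ coeff 0 := by
    refine hom_ext_basis_tmul fun k v => ?_
    simp only [LinearMap.comp_apply,
      LieModule.toEnd_apply_apply, TensorProduct.LieModule.lie_tmul_right, Verma.lie_f_basis,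
      map_add, coeff_basis_tmul]
    split_ifs <;> simp_all
  exact LinearMap.congr_fun this t

theorem coeff_succ_lie_f (n : ℕ) (t : Verma b ⊗[ℂ] V) :
    coeff (n + 1) ⁅f, t⁆ = coeff n t + ⁅f, coeff (n + 1) t⁆ := by
  have : coeff (n + 1) ∘ₗ LieModule.toEnd ℂ sl2 (Verma b ⊗[ℂ] V) f =
      coeff n + LieModule.toEnd ℂ sl2 V f ∘ₗ coeff (n + 1) := by
    refine hom_ext_basis_tmul fun k v => ?_
    simp only [LinearMap.comp_apply, LinearMap.add_apply,
      LieModule.toEnd_apply_apply, TensorProduct.LieModule.lie_tmul_right, Verma.lie_f_basis,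
      map_add, coeff_basis_tmul, add_left_inj]
    split_ifs <;> simp
  exact LinearMap.congr_fun this t

theorem coeff_zero_powF (n : ℕ) (t : Verma b ⊗[ℂ] V) :
    coeff 0 (powF _ n t) = powF V n (coeff 0 t) := by
  induction n with
  | zero => simp
  | succ n ih => rw [powF_succ, powF_succ, coeff_zero_lie_f, ih]

/-- The binomial expansion of (f ⊗ 1 + 1 ⊗ f)ⁿ. Diagonal entries need only p = 0, but
`coeff_succ_lie_f` involves two neighbouring shifts, so the induction runs over all p. -/
theorem coeff_add_powF (n p : ℕ) (t : Verma b ⊗[ℂ] V) :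
    coeff (n + p) (powF _ n t) =
      ∑ j ∈ Finset.range (n + 1), (n.choose j : ℂ) • powF V j (coeff (p + j) t) := by
  induction n generalizing p with
  | zero => simp
  | succ n ih =>
    rw [powF_succ, show n + 1 + p = (n + p) + 1 by ring, coeff_succ_lie_f, ih,
      show n + p + 1 = n + (p + 1) by ring, ih, lie_sum, Finset.sum_range_succ' _ (n + 1)]
    rw [Finset.sum_range_succ' (fun j => (n.choose j : ℂ) • powF V j (coeff (p + j) t)) n]
    have h1 : ∑ k ∈ Finset.range n, ((n.choose (k + 1) : ℕ) : ℂ) •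
        powF V (k + 1) (coeff (p + (k + 1)) t) = ∑ k ∈ Finset.range (n + 1),
          ((n.choose (k + 1) : ℕ) : ℂ) • powF V (k + 1) (coeff (p + (k + 1)) t) := by
      rw [Finset.sum_range_succ _ n]
      simp
    rw [h1, add_right_comm, ← Finset.sum_add_distrib]
    congr 1
    · refine Finset.sum_congr rfl fun k _ => ?_
      rw [Nat.choose_succ_succ, lie_smul, ← powF_succ, show p + 1 + k = p + (k + 1) by ring]
      push_cast
      module
    · simp

theorem coeff_powF (n : ℕ) (t : Verma b ⊗[ℂ] V) :
    coeff n (powF _ n t) =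
      ∑ j ∈ Finset.range (n + 1), (n.choose j : ℂ) • powF V j (coeff j t) := by
  simpa using coeff_add_powF n 0 t

/-- A vector killed by `e` is determined by its leading coefficient. -/
theorem eq_of_lie_e_eq_zero (hb : ∀ n : ℕ, b ≠ n) {s t : Verma b ⊗[ℂ] V} (hs : ⁅e, s⁆ = 0)
    (ht : ⁅e, t⁆ = 0) (H : coeff 0 s = coeff 0 t) : s = t := by
  refine coeff_ext fun n => ?_
  induction n with
  | zero => exact H
  | succ n ih =>
    have h1 := coeff_lie_e n s
    have h2 := coeff_lie_e n t
    rw [hs, map_zero] at h1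
    rw [ht, map_zero, ← ih] at h2
    have h3 : (((n : ℂ) + 1) * (b - n)) ≠ 0 :=
      mul_ne_zero (Nat.cast_add_one_ne_zero n) (sub_ne_zero.2 (hb n))
    exact smul_right_injective V h3 (add_right_cancel (h1.symm.trans h2))

end Coeff


/-! ### Intertwining operators for zero weight vectors -/

section Intertwiner

variable {a : ℂ} {V : Type*} [AddCommGroup V] [Module ℂ V] [LieRingModule sl2 V]
  [LieModule ℂ sl2 V]

theorem isIntertwiner_iff {b : ℂ} {v : V} {Φ : Verma a →ₗ⁅ℂ, sl2⁆ Verma b ⊗[ℂ] V} :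
    IsIntertwiner a b v Φ ↔ coeff 0 (Φ (Verma.hwv a)) = v := by
  rw [IsIntertwiner, mem_range_lower_iff, map_sub, Verma.hwv, Verma.hwv, coeff_basis_tmul,
    if_pos rfl, sub_eq_zero]

/-- The coefficient of `fⁿ x_a ⊗ eⁿ v` in `Φ_a^v(x_a)`. -/
def intertwinerCoeff (a : ℂ) (n : ℕ) : ℂ :=
  ((n.factorial : ℂ) * (ascPochhammer ℂ n).eval (-a))⁻¹

theorem eval_ascPochhammer_ne_zero {z : ℂ} (hz : ∀ n : ℕ, z ≠ -n) (n : ℕ) :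
    (ascPochhammer ℂ n).eval z ≠ 0 := by
  rw [Ne, ascPochhammer_eval_eq_zero_iff]
  rintro ⟨k, -, hk⟩
  exact hz k (by rw [hk, neg_neg])

theorem intertwinerCoeff_zero (a : ℂ) : intertwinerCoeff a 0 = 1 := by
  simp [intertwinerCoeff]

/-- Precisely the relation that makes ∑ cₙ fⁿ x_a ⊗ eⁿ v be killed by e, in view of `coeff_lie_e`.
-/
theorem intertwinerCoeff_succ (ha : ∀ n : ℕ, a ≠ n) (n : ℕ) :
    (((n : ℂ) + 1) * (a - n)) * intertwinerCoeff a (n + 1) = -intertwinerCoeff a n := by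
  have h1 : ((n : ℂ) + 1) ≠ 0 := Nat.cast_add_one_ne_zero n
  have h2 : a - n ≠ 0 := sub_ne_zero.2 (ha n)
  have h3 : -a + n ≠ 0 := by rw [← neg_ne_zero]; convert h2 using 1; ring
  have h4 : (n.factorial : ℂ) ≠ 0 := Nat.cast_ne_zero.2 n.factorial_ne_zero
  have h5 : (ascPochhammer ℂ n).eval (-a) ≠ 0 :=
    eval_ascPochhammer_ne_zero (fun k hk => ha k (neg_injective hk)) n
  rw [intertwinerCoeff, intertwinerCoeff, ascPochhammer_succ_eval, Nat.factorial_succ]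
  push_cast
  field_simp
  ring

/-- The singular vector `∑ₙ cₙ fⁿ x_a ⊗ eⁿ v` of weight `a` in `M_a ⊗ V`, summed over `n < N`. -/
def singularVec (a : ℂ) (v : V) (N : ℕ) : Verma a ⊗[ℂ] V :=
  ∑ n ∈ Finset.range N, Verma.basis a n ⊗ₜ[ℂ] (intertwinerCoeff a n • powE V n v)

variable [FiniteDimensional ℂ V] {v : V}

/-- Past the cutoff eⁿ v = 0, so the formula holds for every n and does not see N. -/
theorem coeff_singularVec (hv : v ∈ wtSpace V 0) {N : ℕ} (hN : Module.finrank ℂ V < N) (n : ℕ) :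
    coeff n (singularVec a v N) = intertwinerCoeff a n • powE V n v := by
  rw [singularVec, map_sum]
  simp only [coeff_basis_tmul]
  rw [Finset.sum_ite_eq' (Finset.range N)]
  split_ifs with hn
  · rfl
  · rw [Finset.mem_range, not_lt] at hn
    rw [powE_eq_zero (mem_wtSpace.1 hv) (hN.trans_le hn), smul_zero]

theorem lie_e_singularVec (ha : ∀ n : ℕ, a ≠ n) (hv : v ∈ wtSpace V 0) {N : ℕ}
    (hN : Module.finrank ℂ V < N) : ⁅e, singularVec a v N⁆ = 0 := by
  refine coeff_ext fun n => ?_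
  rw [coeff_lie_e, coeff_singularVec hv hN, coeff_singularVec hv hN, smul_smul,
    intertwinerCoeff_succ ha, lie_smul, ← powE_succ, map_zero]
  module

theorem lie_h_singularVec (hv : v ∈ wtSpace V 0) {N : ℕ} (hN : Module.finrank ℂ V < N) :
    ⁅h, singularVec a v N⁆ = a • singularVec a v N := by
  refine coeff_ext fun n => ?_
  rw [coeff_lie_h, map_smul, coeff_singularVec hv hN, lie_smul, lie_h_powE (mem_wtSpace.1 hv)]
  module

theorem existsUnique_isIntertwiner (ha : ∀ n : ℕ, a ≠ n) (hv : v ∈ wtSpace V 0) :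
    ∃! Φ, IsIntertwiner a a v Φ := by
  have hN := Nat.lt_succ_self (Module.finrank ℂ V)
  refine ⟨Verma.lift (singularVec a v _) (lie_e_singularVec ha hv hN) (lie_h_singularVec hv hN),
    ?_, fun Φ hΦ => ?_⟩
  · beta_reduce
    rw [isIntertwiner_iff, Verma.lift_hwv, coeff_singularVec hv hN]
    simp [intertwinerCoeff_zero]
  · have hΦ := isIntertwiner_iff.1 hΦ
    apply Verma.lieHom_ext
    refine eq_of_lie_e_eq_zero ha ?_ ?_ ?_
    · rw [← LieModuleHom.map_lie, Verma.lie_e_hwv, map_zero]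
    · rw [← LieModuleHom.map_lie, Verma.lie_e_hwv, map_zero]
    · rw [hΦ, Verma.lift_hwv, coeff_singularVec hv hN]
      simp [intertwinerCoeff_zero]

theorem isIntertwiner_intertwiner (ha : ∀ n : ℕ, a ≠ n) (hv : v ∈ wtSpace V 0) :
    IsIntertwiner a a v (intertwiner a a v) := by
  have H := existsUnique_isIntertwiner ha hv
  rw [intertwiner, dif_pos H]
  exact H.choose_spec.1

theorem coeff_zero_intertwiner_hwv (ha : ∀ n : ℕ, a ≠ n) (hv : v ∈ wtSpace V 0) :
    coeff 0 (intertwiner a a v (Verma.hwv a)) = v :=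
  isIntertwiner_iff.1 (isIntertwiner_intertwiner ha hv)

theorem intertwiner_hwv (ha : ∀ n : ℕ, a ≠ n) (hv : v ∈ wtSpace V 0) {N : ℕ}
    (hN : Module.finrank ℂ V < N) :
    intertwiner a a v (Verma.hwv a) = singularVec a v N := by
  refine eq_of_lie_e_eq_zero ha ?_ (lie_e_singularVec ha hv hN) ?_
  · rw [← LieModuleHom.map_lie, Verma.lie_e_hwv, map_zero]
  · rw [coeff_zero_intertwiner_hwv ha hv, coeff_singularVec hv hN]
    simp [intertwinerCoeff_zero]

theorem coeff_intertwiner_basis (ha : ∀ n : ℕ, a ≠ n) (hv : v ∈ wtSpace V 0) (n : ℕ) :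
    coeff n (intertwiner a a v (Verma.basis a n)) = ∑ j ∈ Finset.range (n + 1),
      ((n.choose j : ℂ) * intertwinerCoeff a j) • powF V j (powE V j v) := by
  rw [Verma.lieHom_basis, coeff_powF, intertwiner_hwv ha hv (Nat.lt_succ_self _)]
  refine Finset.sum_congr rfl fun j _ => ?_
  rw [coeff_singularVec hv (Nat.lt_succ_self _), map_smul, smul_smul]

end Intertwiner

/-! ### The fusion matrix on zero weight vectors -/

section Fusion

theorem coeff_assoc_tmul {a : ℂ} {W V : Type*} [AddCommGroup W] [Module ℂ W] [AddCommGroup V]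
    [Module ℂ V] (n : ℕ) (s : Verma a ⊗[ℂ] W) (v : V) :
    coeff n (TensorProduct.assoc ℂ (Verma a) W V (s ⊗ₜ v)) = coeff n s ⊗ₜ[ℂ] v := by
  induction s with
  | zero => simp
  | add s t hs ht => rw [TensorProduct.add_tmul, map_add, map_add, hs, ht, map_add,
      TensorProduct.add_tmul]
  | tmul m w => rw [TensorProduct.assoc_tmul, coeff_tmul, coeff_tmul, TensorProduct.smul_tmul']

variable {a : ℂ} {W V : Type*} [AddCommGroup W] [Module ℂ W] [LieRingModule sl2 W]
  [LieModule ℂ sl2 W] [AddCommGroup V] [Module ℂ V] [LieRingModule sl2 V] [LieModule ℂ sl2 V]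

theorem lie_assoc {M : Type*} [AddCommGroup M] [Module ℂ M] [LieRingModule sl2 M]
    [LieModule ℂ sl2 M] (x : sl2) (t : (M ⊗[ℂ] W) ⊗[ℂ] V) :
    ⁅x, TensorProduct.assoc ℂ M W V t⁆ = TensorProduct.assoc ℂ M W V ⁅x, t⁆ := by
  induction t with
  | zero => simp
  | add s t hs ht => rw [map_add, lie_add, hs, ht, lie_add, map_add]
  | tmul s v =>
    induction s with
    | zero => simp
    | add s t hs ht => rw [TensorProduct.add_tmul, map_add, lie_add, hs, ht, lie_add, map_add]
    | tmul m w =>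
      simp only [TensorProduct.assoc_tmul, TensorProduct.LieModule.lie_tmul_right,
        TensorProduct.tmul_add, TensorProduct.add_tmul, map_add, add_assoc]

theorem lie_rTensor {M N : Type*} [AddCommGroup M] [Module ℂ M] [LieRingModule sl2 M]
    [LieModule ℂ sl2 M] [AddCommGroup N] [Module ℂ N] [LieRingModule sl2 N] [LieModule ℂ sl2 N]
    (Φ : M →ₗ⁅ℂ, sl2⁆ N) (x : sl2) (t : M ⊗[ℂ] V) :
    ⁅x, LinearMap.rTensor V (Φ : M →ₗ[ℂ] N) t⁆ = LinearMap.rTensor V (Φ : M →ₗ[ℂ] N) ⁅x, t⁆ :=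
  (LieModuleHom.map_lie (TensorProduct.LieModule.map Φ (LieModuleHom.id : V →ₗ⁅ℂ, sl2⁆ V))
    x t).symm

/-- The vector `(Φ_a^w ⊗ 1) Φ_a^v (x_a)`. -/
def composedVec (a : ℂ) (w : W) (v : V) : Verma a ⊗[ℂ] (W ⊗[ℂ] V) :=
  TensorProduct.assoc ℂ (Verma a) W V
    (LinearMap.rTensor V (intertwiner a a w : Verma a →ₗ[ℂ] Verma a ⊗[ℂ] W)
      (intertwiner a a v (Verma.hwv a)))

theorem lie_composedVec (x : sl2) (w : W) (v : V) :
    ⁅x, composedVec a w v⁆ = TensorProduct.assoc ℂ (Verma a) W V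
      (LinearMap.rTensor V (intertwiner a a w : Verma a →ₗ[ℂ] Verma a ⊗[ℂ] W)
        (intertwiner a a v ⁅x, Verma.hwv a⁆)) := by
  rw [composedVec, lie_assoc, lie_rTensor, LieModuleHom.map_lie]

/-- The whole vector has weight a, and x_a already accounts for it. The default value 0 of
`intertwiner` is also a module homomorphism, so the argument covers it. -/
theorem coeff_zero_composedVec_mem (w : W) (v : V) :
    coeff 0 (composedVec a w v) ∈ wtSpace (W ⊗[ℂ] V) 0 := by
  have h1 := coeff_lie_h 0 (composedVec a w v)
  rw [lie_composedVec, Verma.lie_h_hwv, map_smul, map_smul, map_smul, map_smul] at h1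
  change a • coeff 0 (composedVec a w v) = _ at h1
  rw [mem_wtSpace, zero_smul]
  simpa using h1

variable [FiniteDimensional ℂ W] [FiniteDimensional ℂ V] {w : W} {v : V}

/-- Both sides of the fusion equation are killed by e, so the equation reduces to equality of the
coefficients at x_a; on the right this coefficient is j. -/
theorem isFusion_iff (ha : ∀ n : ℕ, a ≠ n) (j : W ⊗[ℂ] V) :
    IsFusion a a a w v j ↔ j = coeff 0 (composedVec a w v) := by
  constructor
  · rintro ⟨hj, H⟩
    rw [sub_self] at hj
    rw [composedVec, H, coeff_zero_intertwiner_hwv ha hj]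
  · rintro rfl
    have hj := coeff_zero_composedVec_mem (a := a) w v
    refine ⟨by rwa [sub_self], ?_⟩
    change composedVec a w v = _
    refine eq_of_lie_e_eq_zero ha ?_ ?_ (coeff_zero_intertwiner_hwv ha hj).symm
    · rw [lie_composedVec, Verma.lie_e_hwv, map_zero, map_zero, map_zero]
    · rw [← LieModuleHom.map_lie, Verma.lie_e_hwv, map_zero]

theorem existsUnique_isFusion (ha : ∀ n : ℕ, a ≠ n) (w : W) (v : V) :
    ∃! j, IsFusion a a a w v j :=
  ⟨_, (isFusion_iff ha _).2 rfl, fun j hj => (isFusion_iff ha j).1 hj⟩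

/-- The first operator sends fⁿ x_a to fⁿ Φ(x_a). Applying f to the Verma factor never produces x_a,
so in the coefficient at x_a all n factors f act on W. -/
theorem fusion_eq_sum (ha : ∀ n : ℕ, a ≠ n) (hw : w ∈ wtSpace W 0) (hv : v ∈ wtSpace V 0) {N : ℕ}
    (hN : Module.finrank ℂ V < N) :
    fusion a a a w v =
      ∑ n ∈ Finset.range N, intertwinerCoeff a n • (powF W n w ⊗ₜ[ℂ] powE V n v) := by
  have H := existsUnique_isFusion (a := a) ha w v
  rw [fusion, dif_pos H, (isFusion_iff ha _).1 H.choose_spec.1, composedVec,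
    intertwiner_hwv ha hv hN, singularVec]
  simp only [TensorProduct.tmul_smul, map_sum, map_smul, LinearMap.rTensor_tmul, coeff_assoc_tmul,
    LieModuleHom.coe_toLinearMap, Verma.lieHom_basis, coeff_zero_powF,
    coeff_zero_intertwiner_hwv ha hw]

end Fusion

/-! ### The operator `Q` on the zero weight space -/

section Q

theorem actU_ι_pow (V : Type*) [AddCommGroup V] [Module ℂ V] [LieRingModule sl2 V]
    [LieModule ℂ sl2 V] (x : sl2) (n : ℕ) :
    actU V (UniversalEnvelopingAlgebra.ι ℂ x ^ n) = LieModule.toEnd ℂ sl2 V x ^ n := by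
  rw [map_pow, actU]
  congr 1
  exact UniversalEnvelopingAlgebra.lift_ι_apply ℂ _ x

variable {a : ℂ} {V : Type*} [AddCommGroup V] [Module ℂ V] [LieRingModule sl2 V]
  [LieModule ℂ sl2 V]

theorem actUU_tmul (W : Type*) [AddCommGroup W] [Module ℂ W] [LieRingModule sl2 W]
    [LieModule ℂ sl2 W] (x y : U) (w : W) (v : V) :
    actUU W V (x ⊗ₜ y) (w ⊗ₜ v) = actU W x w ⊗ₜ[ℂ] actU V y v := rfl

theorem contraction_tmul (x y : U) : contraction (x ⊗ₜ y) = antipode.symm y * x := rfl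

/-- `U(𝔤)` acts on the dual module through the antipode. -/
theorem actU_dual_apply (y : U) (φ : Module.Dual ℂ V) (v : V) :
    actU (Module.Dual ℂ V) y φ v = φ (actU V (antipode.symm y) v) := by
  have key : (MulOpposite.opLinearEquiv ℂ).symm.toLinearMap ∘ₗ antipodeHom.toLinearMap =
      antipode.symm.toLinearMap := rfl
  let : LieRing (Module.End ℂ (Module.Dual ℂ V)) := LieRing.ofAssociativeRing
  -- Transposition and the antipode both reverse products, so their composite is an algebra
  -- homomorphism and need only be compared on `sl2`.
  let T : U →ₐ[ℂ] Module.End ℂ (Module.Dual ℂ V) := AlgHom.ofLinearMap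
    (Module.Dual.transpose ∘ₗ (actU V).toLinearMap ∘ₗ antipode.symm.toLinearMap)
    (by ext; simp [← key, Module.Dual.transpose])
    (by intro x y; ext; simp [← key, Module.Dual.transpose])
  have hT : actU (Module.Dual ℂ V) = T := by
    apply UniversalEnvelopingAlgebra.hom_ext
    ext x φ v
    change actU (Module.Dual ℂ V) (UniversalEnvelopingAlgebra.ι ℂ x) φ v =
      φ (actU V (antipodeHom (UniversalEnvelopingAlgebra.ι ℂ x)).unop v)
    have h1 := actU_ι_pow (Module.Dual ℂ V) x 1
    have h2 := actU_ι_pow V x 1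
    rw [pow_one, pow_one] at h1 h2
    rw [antipodeHom_ι, MulOpposite.unop_op, map_neg, h1, h2]
    simp
  rw [hT]
  rfl

/-- The matrix coefficients of the contraction of `X` only depend on the action of `X`. -/
theorem apply_actU_contraction (X : U ⊗[ℂ] U) (u : V) (φ : Module.Dual ℂ V) :
    φ (actU V (contraction X) u) =
      contractRight ℂ V (actUU V (Module.Dual ℂ V) X (u ⊗ₜ φ)) := by
  induction X with
  | zero => simp
  | add X Y hX hY => simp only [map_add, LinearMap.add_apply, hX, hY]
  | tmul x y =>
    rw [actUU_tmul, contraction_tmul, contractRight_apply, actU_dual_apply, map_mul]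
    rfl

/-- The element of `U(𝔤) ⊗ U(𝔤)` by which the fusion matrix acts on zero weight vectors. -/
def fusionElement (a : ℂ) (N : ℕ) : U ⊗[ℂ] U :=
  ∑ n ∈ Finset.range N, intertwinerCoeff a n •
    ((UniversalEnvelopingAlgebra.ι ℂ f ^ n) ⊗ₜ[ℂ] (UniversalEnvelopingAlgebra.ι ℂ e ^ n))

theorem actUU_fusionElement (W : Type*) [AddCommGroup W] [Module ℂ W] [LieRingModule sl2 W]
    [LieModule ℂ sl2 W] (N : ℕ) (w : W) (v : V) :
    actUU W V (fusionElement a N) (w ⊗ₜ v) =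
      ∑ n ∈ Finset.range N, intertwinerCoeff a n • (powF W n w ⊗ₜ[ℂ] powE V n v) := by
  simp only [fusionElement, map_sum, map_smul, LinearMap.sum_apply, LinearMap.smul_apply,
    actUU_tmul, actU_ι_pow]
  rfl

/-- The choice of X is immaterial by `apply_actU_contraction`, and `fusionElement` provides one, so
the existential becomes an explicit equation. -/
theorem isQZero_iff [FiniteDimensional ℂ V] (ha : ∀ n : ℕ, a ≠ n)
    (q : Module.End ℂ (wtSpace V 0)) :
    IsQZero V a q ↔ ∀ (u : wtSpace V 0) (φ : wtSpace (Module.Dual ℂ V) 0),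
      φ.1 (q u).1 = contractRight ℂ V (fusion a a a u.1 φ.1) := by
  refine forall₂_congr fun u φ => ⟨?_, fun H => ?_⟩
  · rintro ⟨X, hX, H⟩
    rw [H, apply_actU_contraction, hX]
  · have hX : actUU V (Module.Dual ℂ V)
        (fusionElement a (Module.finrank ℂ (Module.Dual ℂ V) + 1)) (u.1 ⊗ₜ[ℂ] φ.1) =
        fusion a a a u.1 φ.1 := by
      rw [actUU_fusionElement, fusion_eq_sum ha u.2 φ.2 (Nat.lt_succ_self _)]
    exact ⟨_, hX, by rw [H, apply_actU_contraction, hX]⟩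

theorem dual_powE_apply (n : ℕ) (φ : Module.Dual ℂ V) (v : V) :
    powE (Module.Dual ℂ V) n φ v = (-1) ^ n * φ (powE V n v) := by
  induction n generalizing v with
  | zero => simp
  | succ n ih =>
    rw [powE_succ, Module.Dual.lie_apply, ih, pow_succ]
    have : powE V n ⁅e, v⁆ = powE V (n + 1) v := by
      rw [powE, powE, pow_succ, Module.End.mul_apply]; rfl
    rw [this]
    ring

theorem dual_powF_apply (n : ℕ) (φ : Module.Dual ℂ V) (v : V) :
    powF (Module.Dual ℂ V) n φ v = (-1) ^ n * φ (powF V n v) := by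
  induction n generalizing v with
  | zero => simp
  | succ n ih =>
    rw [powF_succ, Module.Dual.lie_apply, ih, pow_succ]
    have : powF V n ⁅f, v⁆ = powF V (n + 1) v := by
      rw [powF, powF, pow_succ, Module.End.mul_apply]; rfl
    rw [this]
    ring

end Q


/-! ### Hypergeometric identities -/

section Hypergeometric

theorem eval_ascPochhammer_succ_left (n : ℕ) (z : ℂ) :
    (ascPochhammer ℂ (n + 1)).eval z = z * (ascPochhammer ℂ n).eval (z + 1) := by
  rw [ascPochhammer_succ_left]
  simp [Polynomial.eval_comp]

/-- The Chu–Vandermonde identity `₂F₁(-N, b; c; 1) = (c - b)_N / (c)_N`. -/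
theorem chu_vandermonde (N : ℕ) (b c : ℂ) (hc : ∀ n : ℕ, c ≠ -n) :
    ∑ k ∈ Finset.range (N + 1), (-1) ^ k * (N.choose k : ℂ) *
      ((ascPochhammer ℂ k).eval b / (ascPochhammer ℂ k).eval c) =
      (ascPochhammer ℂ N).eval (c - b) / (ascPochhammer ℂ N).eval c := by
  induction N generalizing b c with
  | zero => simp
  | succ N ih =>
    have hc' : ∀ n : ℕ, c + 1 ≠ -n := fun n hn => hc (n + 1) (by
      push_cast; linear_combination hn)
    have hc0 : c ≠ 0 := by simpa using hc 0
    have h0 := ih b c hc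
    have h1 := ih (b + 1) (c + 1) hc'
    -- Pascal's rule together with (b)_{k+1} = b (b+1)_k expresses the sum for N + 1 through the
    -- sums for N with parameters (b, c) and (b+1, c+1).
    have hsplit : ∑ k ∈ Finset.range (N + 1 + 1), (-1) ^ k * ((N + 1).choose k : ℂ) *
        ((ascPochhammer ℂ k).eval b / (ascPochhammer ℂ k).eval c) =
        ∑ k ∈ Finset.range (N + 1), (-1) ^ k * (N.choose k : ℂ) *
          ((ascPochhammer ℂ k).eval b / (ascPochhammer ℂ k).eval c) -
        b / c * ∑ k ∈ Finset.range (N + 1), (-1) ^ k * (N.choose k : ℂ) *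
          ((ascPochhammer ℂ k).eval (b + 1) / (ascPochhammer ℂ k).eval (c + 1)) := by
      have hlast : ∑ k ∈ Finset.range (N + 1), (-1) ^ k * (N.choose k : ℂ) *
          ((ascPochhammer ℂ k).eval b / (ascPochhammer ℂ k).eval c) =
          ∑ k ∈ Finset.range (N + 1 + 1), (-1) ^ k * (N.choose k : ℂ) *
          ((ascPochhammer ℂ k).eval b / (ascPochhammer ℂ k).eval c) := by
        rw [Finset.sum_range_succ _ (N + 1)]
        simp
      rw [hlast, Finset.sum_range_succ' _ (N + 1), Finset.sum_range_succ' _ (N + 1),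
        Finset.mul_sum, add_sub_right_comm, ← Finset.sum_sub_distrib]
      congr 1
      · refine Finset.sum_congr rfl fun k _ => ?_
        rw [Nat.choose_succ_succ, eval_ascPochhammer_succ_left, eval_ascPochhammer_succ_left,
          mul_div_mul_comm]
        push_cast
        ring
      · simp
    rw [hsplit, h0, h1, add_sub_add_right_eq_sub, ascPochhammer_succ_eval,
      ascPochhammer_succ_eval]
    have hN : (ascPochhammer ℂ N).eval c ≠ 0 := eval_ascPochhammer_ne_zero hc N
    have hN' : (ascPochhammer ℂ N).eval (c + 1) ≠ 0 := eval_ascPochhammer_ne_zero hc' N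
    have hcN : c + N ≠ 0 := fun hn => hc N (eq_neg_of_add_eq_zero_left hn)
    have hrel : c * (ascPochhammer ℂ N).eval (c + 1) = (ascPochhammer ℂ N).eval c * (c + N) := by
      rw [← eval_ascPochhammer_succ_left, ascPochhammer_succ_eval]
    have h2 : b / c * ((ascPochhammer ℂ N).eval (c - b) / (ascPochhammer ℂ N).eval (c + 1)) =
        b * (ascPochhammer ℂ N).eval (c - b) / ((ascPochhammer ℂ N).eval c * (c + N)) := by
      rw [← hrel, div_mul_div_comm]
    rw [h2]
    field_simp
    ring

theorem eval_ascPochhammer_neg_eq_zero {m k : ℕ} (hk : m < k) :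
    (ascPochhammer ℂ k).eval (-(m : ℂ)) = 0 :=
  (ascPochhammer_eval_eq_zero_iff k _).2 ⟨m, hk, by rw [neg_neg]⟩

theorem eval_ascPochhammer_neg_natCast (m k : ℕ) :
    (ascPochhammer ℂ k).eval (-(m : ℂ)) = (-1) ^ k * k.factorial * (m.choose k : ℂ) := by
  induction k with
  | zero => simp
  | succ k ih =>
    rw [ascPochhammer_succ_eval, ih, Nat.factorial_succ]
    have h1 : ((m.choose (k + 1) : ℕ) : ℂ) * ((k : ℂ) + 1) = (m.choose k : ℂ) * ((m : ℂ) - k) := by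
      rcases le_or_gt k m with hk | hk
      · have := Nat.choose_succ_right_eq m k
        rw [← Nat.cast_sub hk]
        exact_mod_cast this
      · rw [Nat.choose_eq_zero_of_lt hk, Nat.choose_eq_zero_of_lt (by omega)]
        simp
    push_cast
    linear_combination (-(-1) ^ (k + 1) * (k.factorial : ℂ)) * h1

theorem eval_ascPochhammer_natCast_add_one (m k : ℕ) :
    (ascPochhammer ℂ k).eval ((m : ℂ) + 1) = (m + k).factorial / m.factorial := by
  have hm : (m.factorial : ℂ) ≠ 0 := Nat.cast_ne_zero.2 m.factorial_ne_zero
  rw [eq_div_iff hm]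
  induction k with
  | zero => simp
  | succ k ih =>
    rw [ascPochhammer_succ_eval, ← add_assoc, Nat.factorial_succ]
    push_cast
    linear_combination ((m : ℂ) + 1 + k) * ih

/-- The coefficients of `₂F₁(-m, m + 1; c; ·)`. -/
def jacobiCoeff (m : ℕ) (c : ℂ) (k : ℕ) : ℂ :=
  ordinaryHypergeometricCoefficient (-(m : ℂ)) ((m : ℂ) + 1) c k

theorem jacobiCoeff_eq_zero {m k : ℕ} (c : ℂ) (hk : m < k) : jacobiCoeff m c k = 0 := by
  rw [jacobiCoeff, ordinaryHypergeometricCoefficient, eval_ascPochhammer_neg_eq_zero hk]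
  simp

theorem jacobiCoeff_eq (m k : ℕ) (c : ℂ) : jacobiCoeff m c k =
    (-1) ^ k * (m.choose k : ℂ) *
      ((ascPochhammer ℂ k).eval ((m : ℂ) + 1) / (ascPochhammer ℂ k).eval c) := by
  have hk : (k.factorial : ℂ) ≠ 0 := Nat.cast_ne_zero.2 k.factorial_ne_zero
  rw [jacobiCoeff, ordinaryHypergeometricCoefficient, eval_ascPochhammer_neg_natCast]
  field_simp

theorem hypergeometric_eq_sum (m : ℕ) (c x : ℂ) :
    ₂F₁ (-(m : ℂ)) ((m : ℂ) + 1) c x =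
      ∑ k ∈ Finset.range (m + 1), jacobiCoeff m c k * x ^ k := by
  rw [ordinaryHypergeometric_eq_tsum]
  refine tsum_eq_sum fun k hk => ?_
  rw [Finset.mem_range, not_lt] at hk
  have := jacobiCoeff_eq_zero c (Nat.lt_of_succ_le hk)
  rw [jacobiCoeff, ordinaryHypergeometricCoefficient] at this
  rw [this, zero_smul]

/-- The value at `1` of `₂F₁(-m, m + 1; c; ·)`. -/
theorem sum_jacobiCoeff (m : ℕ) (c : ℂ) (hc : ∀ n : ℕ, c ≠ -n) :
    ∑ k ∈ Finset.range (m + 1), jacobiCoeff m c k =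
      (ascPochhammer ℂ m).eval (c - ((m : ℂ) + 1)) / (ascPochhammer ℂ m).eval c := by
  rw [← chu_vandermonde m _ c hc]
  exact Finset.sum_congr rfl fun k _ => jacobiCoeff_eq m k c

/-- The negative binomial series shifted by k, the terms with n < k being zero. The trace uses m =
0, Pfaff's transformation general m. -/
theorem hasSum_choose_mul_pow (m k : ℕ) {q : ℂ} (hq : ‖q‖ < 1) :
    HasSum (fun n : ℕ => ((n + m).choose (m + k) : ℂ) * q ^ n) (q ^ k / (1 - q) ^ (m + k + 1)) := by
  have h1 := (hasSum_choose_mul_geometric_of_norm_lt_one (m + k) hq).mul_left (q ^ k)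
  rw [mul_one_div] at h1
  rw [← (add_left_injective k).hasSum_iff]
  · convert! h1 using 2 with n
    simp only [Function.comp_apply]
    rw [show n + k + m = n + (m + k) by ring, pow_add]
    ring
  · intro n hn
    have : n < k := by
      by_contra! hkn
      exact hn ⟨n - k, Nat.sub_add_cancel hkn⟩
    rw [Nat.choose_eq_zero_of_lt (by omega)]
    simp

/-- Comparison of the coefficients of q^N in Pfaff's transformation. After (m+1)_N / N! is factored
out, the sum is Chu–Vandermonde with b = -m. -/
theorem hypergeometricCoefficient_eq_sum (m : ℕ) (c : ℂ) (hc : ∀ n : ℕ, c ≠ -n) (N : ℕ) :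
    ordinaryHypergeometricCoefficient (c + m) ((m : ℂ) + 1) c N =
      ∑ k ∈ Finset.range (m + 1),
        jacobiCoeff m c k * (-1) ^ k * ((N + m).choose (m + k) : ℂ) := by
  have hterm : ∀ k, jacobiCoeff m c k * (-1) ^ k * ((N + m).choose (m + k) : ℂ) =
      (N.factorial : ℂ)⁻¹ * (ascPochhammer ℂ N).eval ((m : ℂ) + 1) *
        ((-1) ^ k * (N.choose k : ℂ) *
          ((ascPochhammer ℂ k).eval (-(m : ℂ)) / (ascPochhammer ℂ k).eval c)) := by
    intro k
    rcases le_or_gt k N with hk | hk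
    · have hck := eval_ascPochhammer_ne_zero hc k
      have h1 := fun n : ℕ => Nat.cast_ne_zero (R := ℂ).2 n.factorial_ne_zero
      have h2 := h1 k
      have h3 := h1 N
      have h4 := h1 m
      have h5 := h1 (N - k)
      have h6 := h1 (m + k)
      rw [jacobiCoeff, ordinaryHypergeometricCoefficient, eval_ascPochhammer_natCast_add_one,
        eval_ascPochhammer_natCast_add_one, Nat.cast_choose ℂ hk,
        Nat.cast_choose ℂ (show m + k ≤ N + m by omega), show N + m - (m + k) = N - k by omega,
        add_comm N m]
      field_simp
    · rw [Nat.choose_eq_zero_of_lt hk, Nat.choose_eq_zero_of_lt (show N + m < m + k by omega)]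
      simp
  have hcv := chu_vandermonde N (-(m : ℂ)) c hc
  rw [sub_neg_eq_add] at hcv
  rw [Finset.sum_congr rfl fun k _ => hterm k, ← Finset.mul_sum]
  -- Both sums extend to the larger range: (-m)_k vanishes for k > m and C(N,k) for k > N.
  have hrange : ∑ k ∈ Finset.range (m + 1), (-1) ^ k * (N.choose k : ℂ) *
      ((ascPochhammer ℂ k).eval (-(m : ℂ)) / (ascPochhammer ℂ k).eval c) =
      ∑ k ∈ Finset.range (N + 1), (-1) ^ k * (N.choose k : ℂ) *
      ((ascPochhammer ℂ k).eval (-(m : ℂ)) / (ascPochhammer ℂ k).eval c) := by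
    have h1 : ∀ M, max m N ≤ M → ∑ k ∈ Finset.range (m + 1), (-1) ^ k * (N.choose k : ℂ) *
        ((ascPochhammer ℂ k).eval (-(m : ℂ)) / (ascPochhammer ℂ k).eval c) =
        ∑ k ∈ Finset.range (M + 1), (-1) ^ k * (N.choose k : ℂ) *
        ((ascPochhammer ℂ k).eval (-(m : ℂ)) / (ascPochhammer ℂ k).eval c) := fun M hM => by
      refine Finset.sum_subset (Finset.range_mono (by omega)) fun k _ hk => ?_
      rw [Finset.mem_range, not_lt] at hk
      rw [eval_ascPochhammer_neg_eq_zero hk]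
      simp
    rw [h1 _ le_rfl]
    symm
    refine Finset.sum_subset (Finset.range_mono (by omega)) fun k _ hk => ?_
    rw [Finset.mem_range, not_lt] at hk
    rw [Nat.choose_eq_zero_of_lt hk]
    simp
  rw [hrange, hcv]
  ring

/-- Pfaff's transformation of `₂F₁(-m, m + 1; c; ·)`. -/
theorem hypergeometric_pfaff (m : ℕ) {c : ℂ} (hc : ∀ n : ℕ, c ≠ -n) {q : ℂ} (hq : ‖q‖ < 1) :
    ₂F₁ (-(m : ℂ)) ((m : ℂ) + 1) c (-(q / (1 - q))) =
      (1 - q) ^ (m + 1) * ₂F₁ (c + m) ((m : ℂ) + 1) c q := by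
  have hq1 : 1 - q ≠ 0 := by
    intro h0
    rw [← sub_eq_zero.1 h0, norm_one] at hq
    exact lt_irrefl _ hq
  -- Each term of the polynomial, divided by (1-q)^(m+1), is a multiple of q^k/(1-q)^(m+k+1) and
  -- expands as a power series in q.
  have hsum : HasSum (fun N : ℕ => ordinaryHypergeometricCoefficient (c + m) ((m : ℂ) + 1) c N •
      q ^ N) (∑ k ∈ Finset.range (m + 1),
        jacobiCoeff m c k * (-1) ^ k * (q ^ k / (1 - q) ^ (m + k + 1))) := by
    simp only [hypergeometricCoefficient_eq_sum m c hc, smul_eq_mul, Finset.sum_mul, mul_assoc]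
    refine hasSum_sum fun k _ => ?_
    exact ((hasSum_choose_mul_pow m k hq).mul_left _).mul_left _
  rw [hypergeometric_eq_sum, ordinaryHypergeometric_eq_tsum]
  have := hsum.tsum_eq
  simp only [ordinaryHypergeometricCoefficient] at this
  beta_reduce
  rw [this, Finset.mul_sum]
  refine Finset.sum_congr rfl fun k _ => ?_
  rw [neg_pow, div_pow, show m + k + 1 = (m + 1) + k by ring, pow_add]
  field_simp
  ring

end Hypergeometric


/-! ### The zero weight spaces of `V_γ` and its dual -/

namespace Irrep

variable (m : ℕ)

theorem zeroVec_eq_vec : zeroVec (m + m) = vec (m + m) m := by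
  rw [zeroVec, show (m + m) / 2 = m by omega]

theorem zeroVec_mem : zeroVec (m + m) ∈ wtSpace (Irrep (m + m)) 0 := by
  rw [mem_wtSpace, zeroVec_eq_vec, lie_h_vec]
  push_cast
  congr 1
  ring

theorem zeroCovec_vec (hγ : Even (m + m)) {k : ℕ} :
    (zeroCovec (m + m) hγ).1 (vec (m + m) k) = if k = m then 1 else 0 := by
  change (basis (m + m)).coord ⟨(m + m) / 2, _⟩ (vec (m + m) k) = _
  by_cases hk : k < m + m + 1
  · rw [show vec (m + m) k = basis (m + m) ⟨k, hk⟩ by simp [vec, hk], Module.Basis.coord_apply,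
      Module.Basis.repr_self, Finsupp.single_apply]
    simp only [Fin.mk.injEq, show (m + m) / 2 = m by omega]
  · rw [vec_of_lt _ (by omega), map_zero, if_neg (by omega)]

variable {m}

theorem weight_ne_zero {k : ℕ} (hk : k ≠ m) : -((m + m : ℕ) : ℂ) + 2 * k ≠ 0 := by
  intro h0
  apply hk
  have : (2 : ℂ) * k = 2 * m := by push_cast at h0; linear_combination h0
  exact_mod_cast mul_left_cancel₀ two_ne_zero this

theorem eq_smul_zeroCovec (hγ : Even (m + m)) {η : Module.Dual ℂ (Irrep (m + m))}
    (hη : η ∈ wtSpace (Module.Dual ℂ (Irrep (m + m))) 0) :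
    η = η (zeroVec (m + m)) • (zeroCovec (m + m) hγ).1 := by
  refine (basis (m + m)).ext fun k => ?_
  rw [basis_eq_vec, LinearMap.smul_apply, zeroCovec_vec]
  split_ifs with hk
  · rw [hk, zeroVec_eq_vec, smul_eq_mul, mul_one]
  · have h1 := LinearMap.congr_fun (mem_wtSpace.1 hη) (vec (m + m) k)
    rw [Module.Dual.lie_apply, lie_h_vec, zero_smul, LinearMap.zero_apply, map_smul, neg_eq_zero,
      smul_eq_mul] at h1
    rw [(mul_eq_zero.1 h1).resolve_left (weight_ne_zero hk), smul_zero]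

theorem eq_smul_zeroVec (hγ : Even (m + m)) {u : Irrep (m + m)}
    (hu : u ∈ wtSpace (Irrep (m + m)) 0) :
    u = (zeroCovec (m + m) hγ).1 u • zeroVec (m + m) := by
  have hcoord : ∀ k : Fin (m + m + 1), (k : ℕ) ≠ m → (basis (m + m)).repr u k = 0 := by
    intro k hk
    have hc : (basis (m + m)).coord k ∘ₗ LieModule.toEnd ℂ sl2 (Irrep (m + m)) h =
        (-((m + m : ℕ) : ℂ) + 2 * (k : ℕ)) • (basis (m + m)).coord k := by
      refine (basis (m + m)).ext fun j => ?_
      rw [LinearMap.comp_apply, LieModule.toEnd_apply_apply, basis_eq_vec, lie_h_vec,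
        ← basis_eq_vec, map_smul, LinearMap.smul_apply, Module.Basis.coord_apply,
        Module.Basis.repr_self, Finsupp.single_apply]
      split_ifs with hj
      · rw [hj]
      · simp
    have h1 := LinearMap.congr_fun hc u
    rw [LinearMap.comp_apply, LieModule.toEnd_apply_apply, mem_wtSpace.1 hu, zero_smul, map_zero,
      LinearMap.smul_apply, smul_eq_mul] at h1
    exact (mul_eq_zero.1 h1.symm).resolve_left (weight_ne_zero hk)
  have hsum := (basis (m + m)).sum_repr u
  rw [Finset.sum_eq_single (⟨m, by omega⟩ : Fin (m + m + 1))
    (fun k _ hk => by rw [hcoord k fun h0 => hk (Fin.ext h0), zero_smul])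
    (fun h0 => absurd (Finset.mem_univ _) h0), basis_eq_vec] at hsum
  rw [← hsum, map_smul, zeroCovec_vec, if_pos rfl, zeroVec_eq_vec, smul_eq_mul, mul_one]

theorem powE_zeroVec (n : ℕ) : powE (Irrep (m + m)) n (zeroVec (m + m)) =
    ((-1) ^ n * (ascPochhammer ℂ n).eval (-(m : ℂ))) • vec (m + m) (m + n) := by
  induction n with
  | zero => simp [zeroVec_eq_vec]
  | succ n ih =>
    rw [powE_succ, ih, lie_smul, lie_e_vec, ascPochhammer_succ_eval, smul_smul, ← add_assoc]
    push_cast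
    congr 1
    ring

theorem powF_vec {n : ℕ} (hn : n ≤ m) : powF (Irrep (m + m)) n (vec (m + m) (m + n)) =
    (ascPochhammer ℂ n).eval ((m : ℂ) + 1) • zeroVec (m + m) := by
  induction n with
  | zero => simp [zeroVec_eq_vec]
  | succ n ih =>
    have h1 : powF (Irrep (m + m)) (n + 1) (vec (m + m) (m + (n + 1))) =
        powF (Irrep (m + m)) n ⁅f, vec (m + m) (m + (n + 1))⁆ := by
      rw [powF, powF, pow_succ, Module.End.mul_apply]; rfl
    rw [h1, lie_f_vec _ (by omega), map_smul, show m + (n + 1) - 1 = m + n by omega,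
      ih (by omega), smul_smul, ascPochhammer_succ_eval]
    push_cast
    congr 1
    ring

/-- The eigenvalue of `fⁿ eⁿ` on `V_{2m}[0]`. -/
def zeroEigenvalue (m n : ℕ) : ℂ :=
  (-1) ^ n * (ascPochhammer ℂ n).eval (-(m : ℂ)) * (ascPochhammer ℂ n).eval ((m : ℂ) + 1)

theorem powF_powE_zeroVec (n : ℕ) :
    powF (Irrep (m + m)) n (powE (Irrep (m + m)) n (zeroVec (m + m))) =
      zeroEigenvalue m n • zeroVec (m + m) := by
  rw [powE_zeroVec, map_smul]
  -- For n > m the vector eⁿ v₀ is already zero, which the factor (-m)_n records.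
  rcases le_or_gt n m with hn | hn
  · rw [powF_vec hn, smul_smul, zeroEigenvalue]
  · simp [zeroEigenvalue, eval_ascPochhammer_neg_eq_zero hn]

theorem powF_powE_of_mem {u : Irrep (m + m)} (hu : u ∈ wtSpace (Irrep (m + m)) 0) (n : ℕ) :
    powF (Irrep (m + m)) n (powE (Irrep (m + m)) n u) = zeroEigenvalue m n • u := by
  rw [eq_smul_zeroVec ⟨m, rfl⟩ hu, map_smul, map_smul, powF_powE_zeroVec, smul_comm]

/-- Passing to the dual reverses the order and the signs (-1)ⁿ cancel, so eⁿ fⁿ on the dual is the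
transpose of fⁿ eⁿ. -/
theorem powE_powF_dual_of_mem {η : Module.Dual ℂ (Irrep (m + m))}
    (hη : η ∈ wtSpace (Module.Dual ℂ (Irrep (m + m))) 0) (n : ℕ) :
    powE (Module.Dual ℂ (Irrep (m + m))) n (powF (Module.Dual ℂ (Irrep (m + m))) n η) =
      zeroEigenvalue m n • η := by
  have hmem : powE (Module.Dual ℂ (Irrep (m + m))) n
      (powF (Module.Dual ℂ (Irrep (m + m))) n η) ∈ wtSpace (Module.Dual ℂ (Irrep (m + m))) 0 := by
    rw [mem_wtSpace, lie_h_powE (lie_h_powF (mem_wtSpace.1 hη) n)]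
    congr 1
    ring
  rw [eq_smul_zeroCovec ⟨m, rfl⟩ hmem, dual_powE_apply, dual_powF_apply, powF_powE_zeroVec,
    map_smul, ← mul_assoc, ← mul_pow, neg_one_mul, neg_neg, one_pow, one_mul, smul_eq_mul,
    mul_smul, ← eq_smul_zeroCovec ⟨m, rfl⟩ hη]

/-- The point where the hypergeometric polynomial enters, both for Q and for the trace. -/
theorem intertwinerCoeff_mul_zeroEigenvalue (a : ℂ) (n : ℕ) :
    intertwinerCoeff a n * zeroEigenvalue m n = (-1) ^ n * jacobiCoeff m (-a) n := by
  rw [intertwinerCoeff, zeroEigenvalue, jacobiCoeff, ordinaryHypergeometricCoefficient, mul_inv]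
  ring

/-- The scalar by which `Q(a)` acts on the zero weight space of `V_{2m}^*`. -/
def qScalar (m : ℕ) (a : ℂ) : ℂ := ∑ n ∈ Finset.range (m + 1), jacobiCoeff m (-a) n

theorem contractRight_fusion {a : ℂ} (ha : ∀ n : ℕ, a ≠ n)
    {u : Module.Dual ℂ (Irrep (m + m))} (hu : u ∈ wtSpace (Module.Dual ℂ (Irrep (m + m))) 0)
    {φ : Module.Dual ℂ (Module.Dual ℂ (Irrep (m + m)))}
    (hφ : φ ∈ wtSpace (Module.Dual ℂ (Module.Dual ℂ (Irrep (m + m)))) 0) :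
    contractRight ℂ (Module.Dual ℂ (Irrep (m + m))) (fusion a a a u φ) = qScalar m a * φ u := by
  -- N must be a valid cutoff for the fusion sum and also cover the m + 1 nonzero coefficients.
  obtain ⟨N, hN, hmN⟩ : ∃ N, Module.finrank ℂ (Module.Dual ℂ (Module.Dual ℂ (Irrep (m + m)))) < N ∧
      m + 1 ≤ N := ⟨_, Nat.lt_succ_of_le (Nat.le_add_right _ m), by omega⟩
  rw [fusion_eq_sum ha hu hφ hN, map_sum, qScalar, Finset.sum_mul]
  symm
  rw [Finset.sum_subset (Finset.range_mono hmN) fun n _ hn => ?_]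
  · refine Finset.sum_congr rfl fun n _ => ?_
    rw [map_smul, contractRight_apply, dual_powE_apply, powE_powF_dual_of_mem hu, map_smul,
      smul_eq_mul, smul_eq_mul]
    have h1 := intertwinerCoeff_mul_zeroEigenvalue (m := m) a n
    have h2 : ((-1 : ℂ) ^ n) * (-1) ^ n = 1 := by rw [← mul_pow]; simp
    linear_combination (-(φ u) * (-1) ^ n) * h1 - (jacobiCoeff m (-a) n * φ u) * h2
  · rw [Finset.mem_range, not_lt] at hn
    rw [jacobiCoeff_eq_zero _ hn, zero_mul]

theorem isQZero_iff_eq_smul {a : ℂ} (ha : ∀ n : ℕ, a ≠ n)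
    (q : Module.End ℂ (wtSpace (Module.Dual ℂ (Irrep (m + m))) 0)) :
    IsQZero (Module.Dual ℂ (Irrep (m + m))) a q ↔ q = qScalar m a • 1 := by
  rw [isQZero_iff ha]
  constructor
  · intro H
    refine LinearMap.ext fun u => Subtype.ext ?_
    -- Evaluation at v₀ has weight zero and separates the points of the line V^*[0], so this one
    -- test functional determines q.
    have hφ : Module.Dual.eval ℂ (Irrep (m + m)) (zeroVec (m + m)) ∈
        wtSpace (Module.Dual ℂ (Module.Dual ℂ (Irrep (m + m)))) 0 := by
      rw [mem_wtSpace, zero_smul]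
      ext η
      rw [Module.Dual.lie_apply, Module.Dual.eval_apply, Module.Dual.lie_apply,
        mem_wtSpace.1 (zeroVec_mem m)]
      simp
    have h1 := H u ⟨_, hφ⟩
    rw [contractRight_fusion ha u.2 hφ] at h1
    rw [eq_smul_zeroCovec ⟨m, rfl⟩ (q u).2]
    change (q u).1 (zeroVec (m + m)) = qScalar m a * u.1 (zeroVec (m + m)) at h1
    change _ = qScalar m a • u.1
    rw [h1, mul_smul, ← eq_smul_zeroCovec ⟨m, rfl⟩ u.2]
  · rintro rfl u φ
    rw [contractRight_fusion ha u.2 φ.2]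
    change φ.1 (qScalar m a • u.1) = _
    rw [map_smul, smul_eq_mul]

theorem existsUnique_isQZero {a : ℂ} (ha : ∀ n : ℕ, a ≠ n) :
    ∃! q, IsQZero (Module.Dual ℂ (Irrep (m + m))) a q :=
  ⟨_, (isQZero_iff_eq_smul ha _).2 rfl, fun q hq => (isQZero_iff_eq_smul ha q).1 hq⟩

theorem QZero_eq {a : ℂ} (ha : ∀ n : ℕ, a ≠ n) :
    QZero (Module.Dual ℂ (Irrep (m + m))) a = qScalar m a • 1 := by
  have H := existsUnique_isQZero (m := m) ha
  rw [QZero, dif_pos H]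
  exact (isQZero_iff_eq_smul ha _).1 H.choose_spec.1

/-- Reverse the order of the factors z-m, …, z-1 and change all their signs. -/
theorem eval_ascPochhammer_sub (m : ℕ) (z : ℂ) :
    (ascPochhammer ℂ m).eval (z - m) = (-1) ^ m * (ascPochhammer ℂ m).eval (-z + 1) := by
  induction m with
  | zero => simp
  | succ m ih =>
    rw [eval_ascPochhammer_succ_left, ascPochhammer_succ_eval]
    push_cast
    rw [show z - ((m : ℂ) + 1) + 1 = z - m by ring, ih]
    ring

theorem qScalar_eq (m : ℕ) {μ : ℂ} (hμ : ∀ n : ℕ, μ ≠ -((n : ℂ) + 1)) :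
    qScalar m (-μ - 1) =
      (-1) ^ m * (ascPochhammer ℂ m).eval (-μ + 1) / (ascPochhammer ℂ m).eval (μ + 1) := by
  have hc : ∀ n : ℕ, μ + 1 ≠ -n := fun n hn => hμ n (by linear_combination hn)
  rw [qScalar, show -(-μ - 1) = μ + 1 by ring, sum_jacobiCoeff m _ hc,
    show μ + 1 - ((m : ℂ) + 1) = μ - m by ring, eval_ascPochhammer_sub]

end Irrep

/-! ### Weighted traces -/

section Trace

theorem HasSumWeak.unique {X : Type*} [AddCommGroup X] [Module ℂ X] {s : ℕ → X} {x y : X}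
    (hx : HasSumWeak s x) (hy : HasSumWeak s y) : x = y := by
  rw [← sub_eq_zero, ← Module.forall_dual_apply_eq_zero_iff ℂ]
  intro ψ
  rw [map_sub, (hx ψ).unique (hy ψ), sub_self]

theorem HasSumWeak.sumWeak_eq {X : Type*} [AddCommGroup X] [Module ℂ X] {s : ℕ → X} {x : X}
    (hx : HasSumWeak s x) : sumWeak s = x := by
  have H : ∃ x, HasSumWeak s x := ⟨x, hx⟩
  rw [sumWeak, dif_pos H]
  exact H.choose_spec.unique hx

variable {m : ℕ} {ι : Type*} [Fintype ι] [DecidableEq ι]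
  {B : Module.Basis ι ℂ (wtSpace (Irrep (m + m)) 0)}
  {Bd : ι → wtSpace (Module.Dual ℂ (Irrep (m + m))) 0}

/-- The canonical element of V[0] ⊗ V^*[0] does not depend on the basis, and both spaces are lines.
-/
theorem sum_basis_tmul_dualBasis (hγ : Even (m + m)) (hB : IsDualBasis B Bd) :
    ∑ i, (B i).1 ⊗ₜ[ℂ] Bd i = Irrep.zeroVec (m + m) ⊗ₜ[ℂ] Irrep.zeroCovec (m + m) hγ := by
  have hBd : ∀ i, Bd i = (Bd i).1 (Irrep.zeroVec (m + m)) • Irrep.zeroCovec (m + m) hγ :=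
    fun i => Subtype.ext (Irrep.eq_smul_zeroCovec hγ (Bd i).2)
  have hcoord : ∀ i, (Bd i).1 (Irrep.zeroVec (m + m)) =
      B.repr ⟨_, Irrep.zeroVec_mem m⟩ i := by
    intro i
    have : (Bd i).1 ∘ₗ (wtSpace (Irrep (m + m)) 0).subtype = B.coord i := by
      refine B.ext fun j => ?_
      rw [LinearMap.comp_apply, Submodule.subtype_apply, hB, Module.Basis.coord_apply,
        Module.Basis.repr_self, Finsupp.single_apply]
      simp only [eq_comm]
    exact LinearMap.congr_fun this ⟨_, Irrep.zeroVec_mem m⟩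
  have hsum : ∑ i, (Bd i).1 (Irrep.zeroVec (m + m)) • (B i).1 = Irrep.zeroVec (m + m) := by
    have := congrArg Subtype.val (B.sum_repr ⟨_, Irrep.zeroVec_mem m⟩)
    rw [AddSubmonoidClass.coe_finsetSum] at this
    simpa only [hcoord, SetLike.val_smul] using this
  calc ∑ i, (B i).1 ⊗ₜ[ℂ] Bd i
      = ∑ i, ((Bd i).1 (Irrep.zeroVec (m + m)) • (B i).1) ⊗ₜ[ℂ] Irrep.zeroCovec (m + m) hγ :=
        Finset.sum_congr rfl fun i _ => by
          conv_lhs => rw [hBd i]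
          rw [TensorProduct.tmul_smul, TensorProduct.smul_tmul']
    _ = _ := by rw [← TensorProduct.sum_tmul, hsum]

/-- Only the operators f^j e^j contribute on the diagonal, and they act on V[0] by scalars, so every
entry is a multiple of the same tensor. -/
theorem diagEntry_zeroIntertwiner (hγ : Even (m + m)) (hB : IsDualBasis B Bd) {a : ℂ}
    (ha : ∀ n : ℕ, a ≠ n) (l : ℂ) (n : ℕ) :
    diagEntry (zeroIntertwiner a B Bd ∘ₗ expVerma l a) n =
      (Complex.exp (pairing l (a - 2 * n)) * ∑ j ∈ Finset.range (n + 1),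
        (n.choose j : ℂ) * ((-1) ^ j * jacobiCoeff m (-a) j)) •
        (Irrep.zeroVec (m + m) ⊗ₜ[ℂ] Irrep.zeroCovec (m + m) hγ) := by
  change coeff n ((zeroIntertwiner a B Bd ∘ₗ expVerma l a) (Verma.basis a n)) = _
  rw [LinearMap.comp_apply, expVerma, Module.Basis.constr_basis, map_smul, map_smul, mul_smul]
  congr 1
  rw [zeroIntertwiner, LinearMap.sum_apply, map_sum, ← sum_basis_tmul_dualBasis hγ hB,
    Finset.smul_sum]
  refine Finset.sum_congr rfl fun i _ => ?_
  change coeff n (TensorProduct.assoc ℂ _ _ _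
    (intertwiner a a (B i).1 (Verma.basis a n) ⊗ₜ[ℂ] Bd i)) = _
  rw [coeff_assoc_tmul, coeff_intertwiner_basis ha (B i).2, TensorProduct.smul_tmul',
    Finset.sum_smul]
  congr 1
  refine Finset.sum_congr rfl fun j _ => ?_
  rw [Irrep.powF_powE_of_mem (B i).2, smul_smul, mul_assoc,
    Irrep.intertwinerCoeff_mul_zeroEigenvalue]

theorem hasSum_choose_mul_jacobiCoeff (m : ℕ) (c : ℂ) {q : ℂ} (hq : ‖q‖ < 1) :
    HasSum (fun n : ℕ => q ^ n * ∑ j ∈ Finset.range (n + 1),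
        (n.choose j : ℂ) * ((-1) ^ j * jacobiCoeff m c j))
      ((1 - q)⁻¹ * ₂F₁ (-(m : ℂ)) ((m : ℂ) + 1) c (-(q / (1 - q)))) := by
  -- The inner range is made independent of n, so that the sum over n can be taken for each j
  -- separately: C(n,j) kills j > n and the coefficient kills j > m.
  have h1 : ∀ n : ℕ, ∑ j ∈ Finset.range (n + 1),
      (n.choose j : ℂ) * ((-1) ^ j * jacobiCoeff m c j) = ∑ j ∈ Finset.range (m + 1),
      (n.choose j : ℂ) * ((-1) ^ j * jacobiCoeff m c j) := by
    intro n
    trans ∑ j ∈ Finset.range (n + m + 1), (n.choose j : ℂ) * ((-1) ^ j * jacobiCoeff m c j)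
    · refine Finset.sum_subset (Finset.range_mono (by omega)) fun k _ hk => ?_
      rw [Finset.mem_range, not_lt] at hk
      rw [Nat.choose_eq_zero_of_lt hk]
      simp
    · symm
      refine Finset.sum_subset (Finset.range_mono (by omega)) fun k _ hk => ?_
      rw [Finset.mem_range, not_lt] at hk
      rw [jacobiCoeff_eq_zero c hk]
      simp
  simp only [h1, hypergeometric_eq_sum, Finset.mul_sum]
  refine hasSum_sum fun j _ => ?_
  have h2 := (hasSum_choose_mul_pow 0 j hq).mul_left ((-1) ^ j * jacobiCoeff m c j)
  simp only [add_zero, zero_add] at h2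
  have h3 : (-1) ^ j * jacobiCoeff m c j * (q ^ j / (1 - q) ^ (j + 1)) =
      (1 - q)⁻¹ * (jacobiCoeff m c j * (-(q / (1 - q))) ^ j) := by
    rw [neg_pow (q / _), div_pow, pow_succ]
    field_simp
  rw [h3] at h2
  convert! h2 using 2 with n
  ring

theorem exp_pairing (l a : ℂ) (n : ℕ) : Complex.exp (pairing l (a - 2 * n)) =
    Complex.exp (l * a / 2) * Complex.exp (-l) ^ n := by
  rw [← Complex.exp_nat_mul, ← Complex.exp_add, pairing]
  congr 1
  ring

theorem hasSumWeak_diagEntry (hγ : Even (m + m)) (hB : IsDualBasis B Bd) {a : ℂ}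
    (ha : ∀ n : ℕ, a ≠ n) {l : ℂ} (hl : ‖Complex.exp (-l)‖ < 1) :
    HasSumWeak (diagEntry (zeroIntertwiner a B Bd ∘ₗ expVerma l a))
      ((Complex.exp (l * a / 2) * ((1 - Complex.exp (-l))⁻¹ *
        ₂F₁ (-(m : ℂ)) ((m : ℂ) + 1) (-a) (-(Complex.exp (-l) / (1 - Complex.exp (-l)))))) •
        (Irrep.zeroVec (m + m) ⊗ₜ[ℂ] Irrep.zeroCovec (m + m) hγ)) := by
  intro ψ
  simp only [diagEntry_zeroIntertwiner hγ hB ha, map_smul, smul_eq_mul, exp_pairing, mul_assoc]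
  rw [← mul_assoc (1 - Complex.exp (-l))⁻¹]
  have h1 := (((hasSum_choose_mul_jacobiCoeff m (-a) hl).mul_left (Complex.exp (l * a / 2))).mul_right
    (ψ (Irrep.zeroVec (m + m) ⊗ₜ[ℂ] Irrep.zeroCovec (m + m) hγ)))
  simpa only [mul_assoc] using h1

theorem Psi_eq (hγ : Even (m + m)) (hB : IsDualBasis B Bd) {a : ℂ}
    (ha : ∀ n : ℕ, a ≠ n) {l : ℂ} (hl : ‖Complex.exp (-l)‖ < 1) :
    Psi l a B Bd = (Complex.exp (l * a / 2) * ((1 - Complex.exp (-l))⁻¹ *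
        ₂F₁ (-(m : ℂ)) ((m : ℂ) + 1) (-a) (-(Complex.exp (-l) / (1 - Complex.exp (-l)))))) •
        (Irrep.zeroVec (m + m) ⊗ₜ[ℂ] Irrep.zeroCovec (m + m) hγ) :=
  (hasSumWeak_diagEntry hγ hB ha hl).sumWeak_eq

theorem one_sub_exp_neg_ne_zero {l : ℂ} (hl : ‖Complex.exp (-l)‖ < 1) :
    1 - Complex.exp (-l) ≠ 0 := by
  intro h0
  rw [← sub_eq_zero.1 h0, norm_one] at hl
  exact lt_irrefl _ hl

/-- With δ(l) = e^{l/2}(1 - e^{-l}), the second factor cancels the geometric factor of the trace,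
and e^{l/2} undoes the shift by ρ in e^{l(-μ-1)/2}. -/
theorem weightedTrace_eq (hγ : Even (m + m)) (hB : IsDualBasis B Bd) {l μ : ℂ}
    (hl : ‖Complex.exp (-l)‖ < 1) (ha : ∀ n : ℕ, -μ - 1 ≠ n)
    (hq : Irrep.qScalar m (-μ - 1) ≠ 0) :
    weightedTrace l μ B Bd = ((Irrep.qScalar m (-μ - 1))⁻¹ * Complex.exp (-(l * μ / 2)) *
      ₂F₁ (-(m : ℂ)) ((m : ℂ) + 1) (μ + 1) (-(Complex.exp (-l) / (1 - Complex.exp (-l))))) •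
        (Irrep.zeroVec (m + m) ⊗ₜ[ℂ] Irrep.zeroCovec (m + m) hγ) := by
  have hinv : Ring.inverse (Irrep.qScalar m (-μ - 1) •
      (1 : Module.End ℂ (wtSpace (Module.Dual ℂ (Irrep (m + m))) 0))) =
      (Irrep.qScalar m (-μ - 1))⁻¹ • 1 :=
    Ring.inverse_unit ⟨_, _, by simp [hq], by simp [hq]⟩
  rw [weightedTrace, rho, Psi_eq hγ hB ha hl, Irrep.QZero_eq ha, hinv, map_smul,
    LinearMap.lTensor_tmul, LinearMap.smul_apply, Module.End.one_apply, TensorProduct.tmul_smul,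
    smul_smul, smul_smul]
  congr 1
  have h1 : weylDenominator l = Complex.exp (l / 2) * (1 - Complex.exp (-l)) := by
    simp [weylDenominator, pairing, rho]
  have h2 : Complex.exp (l / 2) * Complex.exp (l * (-μ - 1) / 2) =
      Complex.exp (-(l * μ / 2)) := by
    rw [← Complex.exp_add]
    congr 1
    ring
  have h3 := one_sub_exp_neg_ne_zero hl
  rw [h1, ← h2, show -(-μ - 1) = μ + 1 by ring]
  field_simp

end Trace

end SlTwo
end

/-! ### The closed formulas for the weighted trace function -/

open SlTwo in
theorem theorem8p1 (γ : ℕ) (hγ : Even γ) (lam μ : ℂ) (hlam : 0 < lam.re)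
    (hμ : ∀ n : ℕ, μ ≠ -((n : ℂ) + 1))
    (hμ' : ∀ n : ℕ, 1 ≤ n → n ≤ γ / 2 → μ ≠ (n : ℂ)) :
    -- the intertwining operators for zero weight vectors exist and are unique
    (∀ (W : Type) [AddCommGroup W] [Module ℂ W] [LieRingModule sl2 W] [LieModule ℂ sl2 W]
        [FiniteDimensional ℂ W], ∀ w ∈ wtSpace W 0,
      ∃! Φ, IsIntertwiner (-μ - rho) (-μ - rho) w Φ) ∧
    -- so does the fusion matrix on tensor products of zero weight vectors
    (∀ (W V : Type) [AddCommGroup W] [Module ℂ W] [LieRingModule sl2 W] [LieModule ℂ sl2 W]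
        [FiniteDimensional ℂ W] [AddCommGroup V] [Module ℂ V] [LieRingModule sl2 V]
        [LieModule ℂ sl2 V] [FiniteDimensional ℂ V], ∀ w ∈ wtSpace W 0, ∀ v ∈ wtSpace V 0,
      ∃! j, IsFusion (-μ - rho) (-μ - rho) (-μ - rho) w v j) ∧
    -- so does the operator `Q` on the zero weight space of the dual of `V_γ`; it is invertible
    (∃! q, IsQZero (Module.Dual ℂ (Irrep γ)) (-μ - rho) q) ∧
    IsUnit (QZero (Module.Dual ℂ (Irrep γ)) (-μ - rho)) ∧
    ∀ (ι : Type) [Fintype ι] [DecidableEq ι] (B : Module.Basis ι ℂ (wtSpace (Irrep γ) 0))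
      (Bd : ι → wtSpace (Module.Dual ℂ (Irrep γ)) 0), IsDualBasis B Bd →
      -- the trace converges
      HasSumWeak (diagEntry (zeroIntertwiner (-μ - rho) B Bd ∘ₗ expVerma lam (-μ - rho)))
        (Psi lam (-μ - rho) B Bd) ∧
      -- the first formula, with a terminating hypergeometric series
      weightedTrace lam μ B Bd =
        ((-1) ^ (γ / 2) * (ascPochhammer ℂ (γ / 2)).eval (μ + 1) /
              (ascPochhammer ℂ (γ / 2)).eval (-μ + 1) *
            Complex.exp (-(lam * μ / 2)) *
            ₂F₁ (-((γ : ℂ) / 2)) ((γ : ℂ) / 2 + 1) (μ + 1) ((1 - Complex.exp lam)⁻¹)) •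
          (Irrep.zeroVec γ ⊗ₜ[ℂ] Irrep.zeroCovec γ hγ) ∧
      -- the second formula
      weightedTrace lam μ B Bd =
        ((-1) ^ (γ / 2) * (ascPochhammer ℂ (γ / 2)).eval (μ + 1) /
              (ascPochhammer ℂ (γ / 2)).eval (-μ + 1) *
            Complex.exp (-(lam * μ / 2)) * (1 - Complex.exp (-lam)) ^ (γ / 2 + 1) *
            ₂F₁ ((γ : ℂ) / 2 + μ + 1) ((γ : ℂ) / 2 + 1) (μ + 1) (Complex.exp (-lam))) •
          (Irrep.zeroVec γ ⊗ₜ[ℂ] Irrep.zeroCovec γ hγ) := by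
  obtain ⟨m, rfl⟩ := hγ
  have hγ : Even (m + m) := ⟨m, rfl⟩
  have ha : ∀ n : ℕ, -μ - 1 ≠ n := fun n hn => hμ n (by linear_combination -hn)
  have hc : ∀ n : ℕ, μ + 1 ≠ -n := fun n hn => hμ n (by linear_combination hn)
  have hm : (m + m) / 2 = m := by omega
  have hmC : ((m + m : ℕ) : ℂ) / 2 = m := by push_cast; ring
  rw [hm] at hμ'
  -- The zeros of (1-μ)_m are μ = 1, …, m, so this is where the second exclusion on μ makes Q
  -- invertible.
  have hnum : (ascPochhammer ℂ m).eval (-μ + 1) ≠ 0 := by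
    rw [Ne, ascPochhammer_eval_eq_zero_iff]
    rintro ⟨k, hk, hk'⟩
    exact hμ' (k + 1) (by omega) (by omega) (by push_cast; linear_combination -hk')
  have hden : (ascPochhammer ℂ m).eval (μ + 1) ≠ 0 := eval_ascPochhammer_ne_zero hc m
  have hq := Irrep.qScalar_eq m hμ
  have hq0 : Irrep.qScalar m (-μ - 1) ≠ 0 := by
    rw [hq]
    exact div_ne_zero (mul_ne_zero (pow_ne_zero _ (neg_ne_zero.2 one_ne_zero)) hnum) hden
  have hqinv : (Irrep.qScalar m (-μ - 1))⁻¹ =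
      (-1) ^ m * (ascPochhammer ℂ m).eval (μ + 1) / (ascPochhammer ℂ m).eval (-μ + 1) := by
    have h1 : ((-1 : ℂ) ^ m)⁻¹ = (-1) ^ m := by rw [← inv_pow, inv_neg, inv_one]
    rw [hq, inv_div, div_mul_eq_div_div_swap, div_eq_mul_inv _ ((-1 : ℂ) ^ m), h1]
    ring
  have hl : ‖Complex.exp (-lam)‖ < 1 := by
    rw [Complex.norm_exp, Complex.neg_re, Real.exp_lt_one_iff]
    linarith
  have hl1 := one_sub_exp_neg_ne_zero hl
  -- Identifies the argument in the first formula with the one produced by summing the trace in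
  -- powers of q = e^{-λ}.
  have harg : (1 - Complex.exp lam)⁻¹ = -(Complex.exp (-lam) / (1 - Complex.exp (-lam))) := by
    have h1 : Complex.exp lam * Complex.exp (-lam) = 1 := by
      rw [← Complex.exp_add, add_neg_cancel, Complex.exp_zero]
    refine inv_eq_of_mul_eq_one_right ?_
    field_simp
    linear_combination h1
  refine ⟨fun W _ _ _ _ _ w hw => existsUnique_isIntertwiner ha hw,
    fun W V _ _ _ _ _ _ _ _ _ _ w _ v _ => existsUnique_isFusion ha w v,
    Irrep.existsUnique_isQZero ha, ?_, fun ι _ _ B Bd hB => ⟨?_, ?_, ?_⟩⟩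
  · rw [rho, Irrep.QZero_eq ha]
    exact ⟨⟨_, (Irrep.qScalar m (-μ - 1))⁻¹ • 1, by simp [hq0], by simp [hq0]⟩, rfl⟩
  · rw [rho, Psi_eq hγ hB ha hl]
    exact hasSumWeak_diagEntry hγ hB ha hl
  · rw [weightedTrace_eq hγ hB hl ha hq0, hm, hmC, harg, hqinv]
  · rw [weightedTrace_eq hγ hB hl ha hq0, hm, hmC, hqinv, hypergeometric_pfaff m hc hl,
      show (m : ℂ) + μ + 1 = μ + 1 + m by ring]
    congr 1
    ring
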